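/- Let $m\ge 0$ be an integer, $\Sigma_m=\{1,\dots,m\}$, and let $\Sigma_m^*$ be the set of finite words over $\Sigma_m$ (including the empty word), $|w|$ denoting the length of $w$. For a commutative ring $R$ and an $R$-module $M$, a function $f:\Sigma_m^*\to M$ is $(R,m)$-regular if the $R$-module spanned by the maps $f^u:w\mapsto f(uw)$, $u\in\Sigma_m^*$, is finitely generated; it is $(R,m)$-automatic if moreover it takes only finitely many values. A function $f$ is degenerate if $f(w)=0$ for all sufficiently long $w$, and non-degenerate otherwise. The growth degree of $f:\Sigma_m^*\to\mathbb{C}$ is $$\mathrm{GrDeg}(f)=\limsup_{n\to\infty}\ \max_{|w|=n}\frac{\log|f(w)|}{\log n}\in\mathbb{R}\cup\{\pm\infty\},\qquad \log|0|=-\infty .$$ The functions $\Sigma_m^*\to\mathbb{C}$ form a $\mathbb{C}$-algebra under pointwise addition and scalar multiplication and the convolution product $(f\star g)(i_1\cdots i_s)=\sum_{j=0}^{s} f(i_1\cdots i_j)\,g(i_{j+1}\cdots i_s)$; let $\mathcal{R}_0(\Sigma_m)$ be its $\mathbb{C}$-subalgebra generated by the $(\mathbb{C},m)$-automatic functions.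 **Theorem 1.2.** Let $f:\Sigma_m^*\to\mathbb{Z}$ be $(\mathbb{Z},m)$-regular and non-degenerate. Then $\mathrm{GrDeg}(f)\in\mathbb{Z}_{\ge 0}\cup\{\infty\}$. Moreover, $\mathrm{GrDeg}(f)\in\mathbb{Z}_{\ge 0}$ if and only if $f\in\mathcal{R}_0(\Sigma_m)$. -/

import Mathlib

noncomputable section

namespace RegularSeq

/-! Words over the `m`-letter alphabet are lists over `Fin m`; concatenation is `++`, the length
of `w` is `w.length`. -/

/-- `f` is `(R, m)`-regular: the `R`-module spanned by the maps `f^u : w ↦ f (u w)`, with `u`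
ranging over all words, is finitely generated. -/
def IsRegular (R : Type*) [CommRing R] {M : Type*} [AddCommGroup M] [Module R M] {m : ℕ}
    (f : List (Fin m) → M) : Prop :=
  (Submodule.span R (Set.range fun (u : List (Fin m)) (w : List (Fin m)) => f (u ++ w))).FG

/-- `f` is `(R, m)`-automatic: it is `(R, m)`-regular and takes only finitely many values. -/
def IsAutomatic (R : Type*) [CommRing R] {M : Type*} [AddCommGroup M] [Module R M] {m : ℕ}
    (f : List (Fin m) → M) : Prop :=
  IsRegular R f ∧ (Set.range f).Finite

/-- `f` is degenerate: it vanishes on all sufficiently long words. -/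
def IsDegenerate {M : Type*} [Zero M] {m : ℕ} (f : List (Fin m) → M) : Prop :=
  ∃ N : ℕ, ∀ w : List (Fin m), N ≤ w.length → f w = 0

/-- The growth degree
`limsup_{n → ∞} max_{|w| = n} log |f w| / log n`, an extended real number, with
`log |0| = -∞`. -/
def growthDegree {m : ℕ} (f : List (Fin m) → ℂ) : EReal :=
  Filter.limsup (fun n : ℕ => ⨆ w : {w : List (Fin m) // w.length = n},
    if f w.1 = 0 then (⊥ : EReal) else ((Real.log ‖f w.1‖ / Real.log n : ℝ) : EReal)) Filter.atTop

/-- All complex-valued functions on words, to be equipped with pointwise addition and the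
convolution product (a type synonym, so that the pointwise product is not found). -/
def WordSeries (m : ℕ) : Type := List (Fin m) → ℂ

namespace WordSeries

variable {m : ℕ}

/-- A function on words, regarded as an element of `WordSeries m`. -/
def of (f : List (Fin m) → ℂ) : WordSeries m := f

instance : AddCommGroup (WordSeries m) := inferInstanceAs (AddCommGroup (List (Fin m) → ℂ))

instance : Module ℂ (WordSeries m) := inferInstanceAs (Module ℂ (List (Fin m) → ℂ))

/-- The convolution product
`(f ⋆ g) (i₁ ⋯ iₛ) = ∑_{j=0}^{s} f (i₁ ⋯ iⱼ) g (iⱼ₊₁ ⋯ iₛ)`. -/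
def conv (f g : WordSeries m) : WordSeries m := fun w =>
  ∑ j ∈ Finset.range (w.length + 1), f (w.take j) * g (w.drop j)

/-- The unit of convolution: `1` on the empty word and `0` elsewhere. -/
def unit : WordSeries m := fun w => if w = [] then 1 else 0

instance : Mul (WordSeries m) := ⟨conv⟩

instance : One (WordSeries m) := ⟨unit⟩

theorem mul_apply (f g : WordSeries m) (w : List (Fin m)) :
    (f * g) w = ∑ j ∈ Finset.range (w.length + 1), f (w.take j) * g (w.drop j) := rfl

theorem one_apply (w : List (Fin m)) : (1 : WordSeries m) w = if w = [] then 1 else 0 := rfl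

theorem add_apply (f g : WordSeries m) (w : List (Fin m)) : (f + g) w = f w + g w := rfl

theorem zero_apply (w : List (Fin m)) : (0 : WordSeries m) w = 0 := rfl

theorem smul_apply (c : ℂ) (f : WordSeries m) (w : List (Fin m)) : (c • f) w = c * f w := rfl

@[ext] theorem ext {f g : WordSeries m} (h : ∀ w, f w = g w) : f = g := funext h

theorem mul_nil (f g : WordSeries m) : (f * g) [] = f [] * g [] := by
  simp [mul_apply]

/-- `f` precomposed with prepending the letter `a`. -/
def shift (a : Fin m) (f : WordSeries m) : WordSeries m := fun w => f (a :: w)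

theorem mul_cons (f g : WordSeries m) (a : Fin m) (w : List (Fin m)) :
    (f * g) (a :: w) = f [] * g (a :: w) + (shift a f * g) w := by
  rw [mul_apply, List.length_cons, Finset.sum_range_succ', add_comm]
  simp [mul_apply, shift]

theorem left_distrib' (f g h : WordSeries m) : f * (g + h) = f * g + f * h := by
  ext w
  simp only [mul_apply, add_apply, mul_add, Finset.sum_add_distrib]

theorem right_distrib' (f g h : WordSeries m) : (f + g) * h = f * h + g * h := by
  ext w
  simp only [mul_apply, add_apply, add_mul, Finset.sum_add_distrib]

theorem smul_mul' (c : ℂ) (f g : WordSeries m) : (c • f) * g = c • (f * g) := by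
  ext w
  simp only [mul_apply, smul_apply, Finset.mul_sum, mul_assoc]

theorem mul_smul' (c : ℂ) (f g : WordSeries m) : f * (c • g) = c • (f * g) := by
  ext w
  simp only [mul_apply, smul_apply, Finset.mul_sum]
  exact Finset.sum_congr rfl fun j _ => by ring

theorem shift_mul (a : Fin m) (f g : WordSeries m) :
    shift a (f * g) = f [] • shift a g + shift a f * g := by
  ext w
  exact mul_cons f g a w

theorem mul_assoc' (f g h : WordSeries m) : f * g * h = f * (g * h) := by
  ext w
  induction w generalizing f with
  | nil => simp only [mul_nil, mul_assoc]
  | cons a w ih =>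
    rw [mul_cons, mul_cons f, mul_nil, shift_mul, right_distrib', add_apply, ih, smul_mul',
      smul_apply, mul_cons g]
    ring

theorem zero_mul' (f : WordSeries m) : 0 * f = 0 := by
  ext w
  simp [mul_apply, zero_apply]

theorem mul_zero' (f : WordSeries m) : f * 0 = 0 := by
  ext w
  simp [mul_apply, zero_apply]

theorem one_mul' (f : WordSeries m) : 1 * f = f := by
  ext w
  cases w with
  | nil => simp [mul_nil, one_apply]
  | cons a w =>
    have h : shift a (1 : WordSeries m) = 0 := by
      ext v
      simp [shift, one_apply, zero_apply]
    rw [mul_cons, h, zero_mul', zero_apply]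
    simp [one_apply]

theorem mul_one' (f : WordSeries m) : f * 1 = f := by
  ext w
  induction w generalizing f with
  | nil => simp [mul_nil, one_apply]
  | cons a w ih =>
    rw [mul_cons, ih]
    simp [one_apply, shift]

/-- The ring of complex-valued functions on words under pointwise addition and convolution. -/
instance : Ring (WordSeries m) :=
  { (inferInstance : AddCommGroup (WordSeries m)) with
    mul := (· * ·)
    one := 1
    left_distrib := left_distrib'
    right_distrib := right_distrib'
    zero_mul := zero_mul'
    mul_zero := mul_zero'
    mul_assoc := mul_assoc'
    one_mul := one_mul'
    mul_one := mul_one' }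

instance : Algebra ℂ (WordSeries m) := Algebra.ofModule smul_mul' mul_smul'

end WordSeries

/-- `R₀(Σ_m)`: the `ℂ`-algebra generated, under convolution, by the `(ℂ, m)`-automatic
functions. -/
def R₀ (m : ℕ) : Subalgebra ℂ (WordSeries m) :=
  Algebra.adjoin ℂ {g : WordSeries m | ∃ f : List (Fin m) → ℂ, IsAutomatic ℂ f ∧ WordSeries.of f = g}

end RegularSeq

end

/-! Let `V` be the rational span of the translates of `f`, finite-dimensional because `f` is
regular, with letters acting by translation; `f` is then a matrix coefficient. For an invariant `U`,
`finMod T U` collects the vectors whose orbit is finite modulo `U`; iterating it from `⊥` gives a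
chain of layers. When `f` grows polynomially, the layers exhaust `V`, and the growth degree is `k`,
where `k + 1` is the index of the first layer containing `f`.

Exhaustion: polynomial growth puts the eigenvalues of every word in the closed unit disc, and the
integral span of the translates is an invariant lattice, so traces of words are integers bounded by
the dimension (`finite_range_trace`). Words with equal traces against a finite spanning set differ
by an element of the radical of the trace form, which consists of nilpotents. Some vector outside a
proper invariant `U` is sent into `U` by this radical, hence has finite orbit modulo `U`
(`lt_finMod`).

Upper bound and membership in `R₀`: a finite automaton follows a vector up to errors in the previous
layer. Telescoping along its run costs one power of the length (`exists_polynomial_bound`); written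
as a convolution, it expresses `f` through automatic series (`matrixCoeff_mem_R₀`).

Lower bound: a Ramsey-type argument shows that if the powers of each single word have finite orbits
on all translates of a vector, then the whole orbit is finite (`mem_finMod_of_torMod`). So outside a
layer some word pumps along a nonconstant polynomial (`exists_polynomial_pump`), and combining `k`
pumps yields degree at least `k` along words of linear length (`exists_polynomial_curve`). -/

noncomputable section

namespace RegularSeq

/-! ### Words acting on a space, layers of finite orbits, monochromatic factors -/

section Actions

variable {α K V : Type*} [Field K] [AddCommGroup V] [Module K V]

/-- The operator attached to a word; the first letter acts first. -/
def act (T : α → Module.End K V) : List α → Module.End K V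
  | [] => 1
  | a :: w => act T w * T a

variable {T : α → Module.End K V}

@[simp] theorem act_nil : act T [] = 1 := rfl

theorem act_cons (a : α) (w : List α) : act T (a :: w) = act T w * T a := rfl

theorem act_append (u w : List α) : act T (u ++ w) = act T w * act T u := by
  induction u with
  | nil => simp
  | cons a u ih => rw [List.cons_append, act_cons, ih, act_cons, mul_assoc]

theorem act_replicate (n : ℕ) (u : List α) :
    act T (List.replicate n u).flatten = act T u ^ n := by
  induction n with
  | zero => simp
  | succ n ih => rw [List.replicate_succ, List.flatten_cons, act_append, ih, pow_succ]

/-- `U` is stable under all the operators `T a`. -/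
def IsInvariant (T : α → Module.End K V) (U : Submodule K V) : Prop :=
  ∀ a, ∀ x ∈ U, T a x ∈ U

theorem IsInvariant.act_mem {U : Submodule K V} (hU : IsInvariant T U) (w : List α) {x : V}
    (hx : x ∈ U) : act T w x ∈ U := by
  induction w generalizing x with
  | nil => simpa
  | cons a w ih => exact ih (hU a x hx)

theorem isInvariant_bot : IsInvariant T (⊥ : Submodule K V) := by
  intro a x hx
  simp_all

theorem finite_range_of_factor {ι β γ : Type*} {f : ι → β} {g : ι → γ}
    (hf : (Set.range f).Finite) (h : ∀ x y, f x = f y → g x = g y) : (Set.range g).Finite := by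
  classical
  rcases isEmpty_or_nonempty γ with hγ | ⟨⟨c⟩⟩
  · exact Set.toFinite _
  · refine (hf.image (Function.extend f g fun _ => c)).subset ?_
    rintro _ ⟨x, rfl⟩
    refine ⟨f x, ⟨x, rfl⟩, ?_⟩
    exact Function.FactorsThrough.extend_apply (fun a b hab => h a b hab) _ _

/-- The vectors whose orbit is finite modulo `U`. -/
def finMod (T : α → Module.End K V) (U : Submodule K V) : Submodule K V where
  carrier := {v | (Set.range fun w => U.mkQ (act T w v)).Finite}
  zero_mem' := by
    refine (Set.finite_singleton (0 : V ⧸ U)).subset ?_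
    rintro _ ⟨w, rfl⟩
    simp
  add_mem' := by
    intro x y hx hy
    refine (Set.Finite.image2 (· + ·) hx hy).subset ?_
    rintro _ ⟨w, rfl⟩
    exact ⟨_, ⟨w, rfl⟩, _, ⟨w, rfl⟩, by simp⟩
  smul_mem' := by
    intro c x hx
    refine (hx.image (c • ·)).subset ?_
    rintro _ ⟨w, rfl⟩
    exact ⟨_, ⟨w, rfl⟩, by simp⟩

theorem mem_finMod {U : Submodule K V} {v : V} :
    v ∈ finMod T U ↔ (Set.range fun w => U.mkQ (act T w v)).Finite := Iff.rfl

theorem isInvariant_finMod (U : Submodule K V) : IsInvariant T (finMod T U) := by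
  intro a x hx
  refine hx.subset ?_
  rintro _ ⟨w, rfl⟩
  exact ⟨a :: w, rfl⟩

theorem le_finMod {U : Submodule K V} (hU : IsInvariant T U) : U ≤ finMod T U := by
  intro x hx
  refine (Set.finite_singleton (0 : V ⧸ U)).subset ?_
  rintro _ ⟨w, rfl⟩
  simpa using hU.act_mem w hx

theorem mkQ_eq_iff {U : Submodule K V} {x y : V} : U.mkQ x = U.mkQ y ↔ x - y ∈ U := by
  simp only [Submodule.mkQ_apply]
  exact Submodule.Quotient.eq U

theorem isInvariant_iterate {U : Submodule K V} (hU : IsInvariant T U) (l : ℕ) :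
    IsInvariant T ((finMod T)^[l] U) := by
  cases l with
  | zero => exact hU
  | succ l =>
    rw [Function.iterate_succ_apply']
    exact isInvariant_finMod _

theorem iterate_le_succ {U : Submodule K V} (hU : IsInvariant T U) (l : ℕ) :
    (finMod T)^[l] U ≤ (finMod T)^[l + 1] U := by
  rw [Function.iterate_succ_apply']
  exact le_finMod (isInvariant_iterate hU l)

theorem iterate_mono {U : Submodule K V} (hU : IsInvariant T U) :
    Monotone fun l => (finMod T)^[l] U :=
  monotone_nat_of_le_succ (iterate_le_succ hU)

/-- Modulo `U`, only finitely many operators on `finMod T U` arise from words. -/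
theorem finite_range_layer [FiniteDimensional K V] (U : Submodule K V) :
    (Set.range fun w => U.mkQ ∘ₗ act T w ∘ₗ (finMod T U).subtype).Finite := by
  let b := Module.finBasis K (finMod T U)
  have h : (Set.range fun (w : List α) i => U.mkQ (act T w (b i))).Finite := by
    refine (Set.Finite.pi fun i => mem_finMod.1 (b i).2).subset ?_
    rintro _ ⟨w, rfl⟩ i -
    exact ⟨w, rfl⟩
  refine finite_range_of_factor h fun w w' hw => b.ext fun i => ?_
  simpa using congrFun hw i

/-- A finite colouring of words makes every long word contain three consecutive factors
`u₁ u₂ u₃` such that `u₁`, `u₂`, `u₃` and `u₁ u₂` have the same colour. -/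
theorem exists_monochromatic_factors {κ : Type*} (c : List α → κ) (hc : (Set.range c).Finite) :
    ∃ L : ℕ, ∀ w : List α, L ≤ w.length → ∃ a u₁ u₂ u₃ b : List α,
      w = a ++ (u₁ ++ (u₂ ++ (u₃ ++ b))) ∧ u₂ ≠ [] ∧ c u₁ = c u₂ ∧ c u₃ = c u₂ ∧
        c (u₁ ++ u₂) = c u₂ := by
  by_contra! H
  choose W hlen hW using H
  -- Compactness replaces Ramsey's theorem: along a nonprincipal ultrafilter the colours of the
  -- segments of the counterexamples `W n` converge to a colouring `k` of pairs, whose iterated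
  -- limit is `e`.
  let 𝒰 : Ultrafilter ℕ := Filter.hyperfilter ℕ
  have hgt (n : ℕ) : ∀ᶠ j in (𝒰 : Filter ℕ), n < j :=
    Nat.hyperfilter_le_atTop (Filter.eventually_gt_atTop n)
  have lim (g : ℕ → κ) (hg : ∀ n, g n ∈ Set.range c) :
      ∃ k ∈ Set.range c, ∀ᶠ n in (𝒰 : Filter ℕ), g n = k := by
    rw [← Ultrafilter.eventually_exists_mem_iff hc]
    exact Filter.Eventually.of_forall fun n => ⟨g n, hg n, rfl⟩
  let seg (n i j : ℕ) : List α := ((W n).drop i).take (j - i)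
  have h1 : ∀ i j, ∃ k ∈ Set.range c, ∀ᶠ n in (𝒰 : Filter ℕ), c (seg n i j) = k :=
    fun i j => lim _ fun n => ⟨_, rfl⟩
  choose k hk hk' using h1
  have h2 : ∀ i, ∃ k' ∈ Set.range c, ∀ᶠ j in (𝒰 : Filter ℕ), k i j = k' :=
    fun i => lim _ (hk i)
  choose q hq hq' using h2
  obtain ⟨e, -, he⟩ := lim q hq
  -- Each new cut point makes the required limit colours with earlier ones equal to `e`; only
  -- afterwards is one word `W n` fixed that realises all four.
  obtain ⟨i₁, h11⟩ := he.exists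
  obtain ⟨i₂, h21, h22, h23⟩ := (he.and ((hgt i₁).and (hq' i₁))).exists
  obtain ⟨i₃, h31, h32, h33, h34⟩ := (he.and ((hgt i₂).and ((hq' i₁).and (hq' i₂)))).exists
  obtain ⟨i₄, h42, h43⟩ := ((hgt i₃).and (hq' i₃)).exists
  obtain ⟨n, hn, a12, a23, a13, a34⟩ := ((hgt i₄).and ((hk' i₁ i₂).and ((hk' i₂ i₃).and
    ((hk' i₁ i₃).and (hk' i₃ i₄))))).exists
  have hcat (i j l : ℕ) (hij : i ≤ j) (hjl : j ≤ l) : seg n i j ++ seg n j l = seg n i l := by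
    obtain ⟨p, rfl⟩ := Nat.exists_eq_add_of_le hij
    obtain ⟨r, rfl⟩ := Nat.exists_eq_add_of_le hjl
    simp only [seg]
    rw [show i + p + r - i = p + r by omega, List.take_add, List.drop_drop]
    simp
  have hl := hlen n
  refine hW n ((W n).take i₁) (seg n i₁ i₂) (seg n i₂ i₃) (seg n i₃ i₄) ((W n).drop i₄) ?_ ?_ ?_
    ?_ ?_
  · rw [← List.append_assoc (seg n i₂ i₃), hcat _ _ _ h32.le h42.le, ← List.append_assoc (seg n i₁ i₂),
      hcat _ _ _ h22.le (h32.trans h42).le]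
    have : (W n).drop i₄ = ((W n).drop i₁).drop (i₄ - i₁) := by
      rw [List.drop_drop]
      congr 1
      omega
    rw [this, List.take_append_drop, List.take_append_drop]
  · intro h0
    have := congrArg List.length h0
    simp only [seg, List.length_take, List.length_drop, List.length_nil] at this
    omega
  · rw [a12, a23, h23, h34, h11, h21]
  · rw [a34, a23, h43, h34, h31, h21]
  · rw [hcat _ _ _ h22.le h32.le, a13, a23, h33, h34, h11, h21]

end Actions

/-! ### From finite orbits under powers to finite orbits under all words -/

section Torsion

variable {α K V : Type*} [Field K] [AddCommGroup V] [Module K V] {T : α → Module.End K V}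

/-- The vectors all of whose translates have, modulo `U`, a finite orbit under the powers of each
word. -/
def torMod (T : α → Module.End K V) (U : Submodule K V) : Submodule K V where
  carrier := {y | ∀ β u : List α, (Set.range fun n : ℕ => U.mkQ ((act T u ^ n) (act T β y))).Finite}
  zero_mem' := by
    intro β u
    refine (Set.finite_singleton (0 : V ⧸ U)).subset ?_
    rintro _ ⟨w, rfl⟩
    simp
  add_mem' := by
    intro x y hx hy β u
    refine (Set.Finite.image2 (· + ·) (hx β u) (hy β u)).subset ?_
    rintro _ ⟨w, rfl⟩
    exact ⟨_, ⟨w, rfl⟩, _, ⟨w, rfl⟩, by simp⟩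
  smul_mem' := by
    intro c x hx β u
    refine ((hx β u).image (c • ·)).subset ?_
    rintro _ ⟨w, rfl⟩
    exact ⟨_, ⟨w, rfl⟩, by simp⟩

theorem act_mem_torMod {U : Submodule K V} {y : V} (hy : y ∈ torMod T U) (w : List α) :
    act T w y ∈ torMod T U := by
  intro β u
  have := hy (w ++ β) u
  simpa only [act_append, Module.End.mul_apply] using this

theorem mem_of_finite_range_smul [CharZero K] {U : Submodule K V} {s z : V}
    (h : (Set.range fun n : ℕ => U.mkQ (s + n • z)).Finite) : z ∈ U := by
  by_contra hz
  have hz' : U.mkQ z ≠ 0 := by simpa using hz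
  refine Set.infinite_range_of_injective (fun a b hab => ?_) h
  simp only [map_add, add_right_inj, map_nsmul] at hab
  rw [← Nat.cast_smul_eq_nsmul K, ← Nat.cast_smul_eq_nsmul K] at hab
  exact_mod_cast smul_left_injective K hz' hab

/-- Allows deletion of the factor `u₂`. On `finMod T U` the three words act, modulo `U`, as one
idempotent, so the only obstruction is the defect `n` of idempotency at `w`. From its square on, the
powers of `u₂` move `w` linearly modulo `U` with step `x₂ n`, which a finite orbit forces into `U`.
-/
theorem act_middle_sub_mem [CharZero K] {U : Submodule K V} (hU : IsInvariant T U)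
    {u₁ u₂ u₃ : List α} {w : V}
    (h1 : ∀ z ∈ finMod T U, act T u₁ z - act T u₂ z ∈ U)
    (h3 : ∀ z ∈ finMod T U, act T u₃ z - act T u₂ z ∈ U)
    (h12 : ∀ z ∈ finMod T U, act T u₂ (act T u₁ z) - act T u₂ z ∈ U)
    (h1w : act T u₁ w - act T u₂ w ∈ finMod T U)
    (h12w : act T u₂ (act T u₁ w) - act T u₂ w ∈ finMod T U)
    (htor : (Set.range fun n : ℕ => U.mkQ ((act T u₂ ^ n) w)).Finite) :
    act T u₃ (act T u₂ (act T u₁ w)) - act T u₃ (act T u₁ w) ∈ U := by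
  set x₁ := act T u₁
  set x₂ := act T u₂
  set x₃ := act T u₃
  have hF := fun u : List α => fun z (hz : z ∈ finMod T U) =>
    (isInvariant_finMod (T := T) U).act_mem u hz
  have hidem : ∀ z ∈ finMod T U, x₂ (x₂ z) - x₂ z ∈ U := by
    intro z hz
    have := U.sub_mem (h12 z hz) (hU.act_mem u₂ (h1 z hz))
    rw [map_sub] at this
    convert this using 1
    abel
  obtain ⟨q, hq⟩ : ∃ q, q = x₁ w - x₂ w := ⟨_, rfl⟩
  obtain ⟨n, hn⟩ : ∃ n, n = x₂ (x₂ w) - x₂ w := ⟨_, rfl⟩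
  have hqm : q ∈ finMod T U := hq ▸ h1w
  have hnm : n ∈ finMod T U := by
    have := (finMod T U).sub_mem h12w (hF u₂ _ h1w)
    rw [map_sub] at this
    convert this using 1
    rw [hn]
    abel
  have hpow : ∀ k : ℕ, (x₂ ^ (k + 1)) n - x₂ n ∈ U := by
    intro k
    induction k with
    | zero => simp
    | succ k ih =>
      have := U.add_mem (hU.act_mem u₂ ih) (hidem n hnm)
      rw [map_sub, sub_add_sub_cancel] at this
      rwa [pow_succ']
  have hlin : ∀ k : ℕ, (x₂ ^ (k + 2)) w - (x₂ (x₂ w) + k • x₂ n) ∈ U := by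
    intro k
    induction k with
    | zero => simp [pow_two]
    | succ k ih =>
      have h := U.add_mem ih (hpow k)
      have e : (x₂ ^ (k + 1)) n = (x₂ ^ (k + 1 + 2)) w - (x₂ ^ (k + 2)) w := by
        rw [hn, map_sub]
        simp [pow_succ]
      rw [e] at h
      convert h using 1
      rw [succ_nsmul]
      abel
  have hxn : x₂ n ∈ U := by
    refine mem_of_finite_range_smul (s := x₂ (x₂ w)) (htor.subset ?_)
    rintro _ ⟨k, rfl⟩
    exact ⟨k + 2, mkQ_eq_iff.2 (hlin k)⟩
  have hx₂q := hF u₂ q hqm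
  have e : x₃ (x₂ (x₁ w)) - x₃ (x₁ w) =
      (x₃ (x₂ q) - x₂ (x₂ q)) + (x₂ (x₂ q) - x₂ q) + (x₃ n - x₂ n) + x₂ n - (x₃ q - x₂ q) := by
    have e1 : x₁ w = x₂ w + q := by rw [hq]; abel
    have e2 : x₂ (x₂ w) = x₂ w + n := by rw [hn]; abel
    rw [e1, map_add, e2, map_add, map_add, map_add]
    abel
  rw [e]
  exact U.sub_mem (U.add_mem (U.add_mem (U.add_mem (h3 _ hx₂q) (hidem q hqm)) (h3 n hnm)) hxn)
    (h3 q hqm)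

theorem layer_eq {U : Submodule K V} {f g : Module.End K V}
    (h : U.mkQ ∘ₗ f ∘ₗ (finMod T U).subtype = U.mkQ ∘ₗ g ∘ₗ (finMod T U).subtype) {z : V}
    (hz : z ∈ finMod T U) : f z - g z ∈ U := by
  have := congrArg (fun φ => φ ⟨z, hz⟩) h
  exact mkQ_eq_iff.1 this

/-- A torsion vector with finite orbit in two steps has finite orbit. -/
theorem mem_finMod_of_torMod_of_finMod_finMod [Finite α] [FiniteDimensional K V] [CharZero K]
    {U : Submodule K V} (hU : IsInvariant T U) {y : V} (hy : y ∈ finMod T (finMod T U))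
    (ht : y ∈ torMod T U) : y ∈ finMod T U := by
  let c (u : List α) := (U.mkQ ∘ₗ act T u ∘ₗ (finMod T U).subtype,
    (finMod T U).mkQ ∘ₗ act T u ∘ₗ (finMod T (finMod T U)).subtype)
  have hc : (Set.range c).Finite := by
    refine ((finite_range_layer (T := T) U).prod (finite_range_layer (T := T) (finMod T U))).subset ?_
    rintro _ ⟨w, rfl⟩
    exact ⟨⟨w, rfl⟩, ⟨w, rfl⟩⟩
  obtain ⟨L, hL⟩ := exists_monochromatic_factors c hc
  have key : ∀ (n : ℕ) (w : List α), w.length = n →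
      ∃ w' : List α, w'.length < L ∧ U.mkQ (act T w y) = U.mkQ (act T w' y) := by
    intro n
    induction n using Nat.strong_induction_on with
    | _ n ih =>
      intro w hw
      by_cases hwL : w.length < L
      · exact ⟨w, hwL, rfl⟩
      obtain ⟨a, u₁, u₂, u₃, b, rfl, hne, h1, h3, h12⟩ := hL w (not_lt.1 hwL)
      have hpos := List.length_pos_iff.2 hne
      obtain ⟨w', hw', he⟩ := ih (a ++ (u₁ ++ (u₃ ++ b))).length (by
        rw [← hw]
        simp only [List.length_append]
        omega) _ rfl
      refine ⟨w', hw', he ▸ mkQ_eq_iff.2 ?_⟩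
      simp only [c, Prod.mk.injEq] at h1 h3 h12
      rw [act_append u₁ u₂] at h12
      have hmem : act T a y ∈ finMod T (finMod T U) := (isInvariant_finMod _).act_mem a hy
      have := act_middle_sub_mem hU (w := act T a y) (fun z hz => layer_eq h1.1 hz)
        (fun z hz => layer_eq h3.1 hz) (fun z hz => layer_eq h12.1 hz) (layer_eq h1.2 hmem)
        (layer_eq h12.2 hmem) (ht a u₂)
      have := hU.act_mem b this
      simpa only [act_append, Module.End.mul_apply, map_sub] using this
  refine ((List.finite_length_lt α L).image fun w => U.mkQ (act T w y)).subset ?_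
  rintro _ ⟨w, rfl⟩
  obtain ⟨w', h, h'⟩ := key _ w rfl
  exact ⟨w', h, h'.symm⟩

theorem mem_finMod_of_torMod [Finite α] [FiniteDimensional K V] [CharZero K]
    {U : Submodule K V} (hU : IsInvariant T U) (l : ℕ) {y : V} (hy : y ∈ (finMod T)^[l] U)
    (ht : y ∈ torMod T U) : y ∈ finMod T U := by
  induction l generalizing y with
  | zero => exact le_finMod hU hy
  | succ l ih =>
    rw [Function.iterate_succ_apply'] at hy
    refine mem_finMod_of_torMod_of_finMod_finMod hU ?_ ht
    refine mem_finMod.2 (finite_range_of_factor (mem_finMod.1 hy) fun w w' h => ?_)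
    rw [mkQ_eq_iff] at h ⊢
    -- The difference of two translates that agree modulo the `l`-th iterate is a torsion vector of
    -- that iterate, so induction puts it in `finMod T U`.
    exact ih h ((torMod T U).sub_mem (act_mem_torMod ht w) (act_mem_torMod ht w'))

end Torsion

/-! ### Powers of one word: eventual idempotence and polynomial dependence -/

section Pumping

variable {α K V : Type*} [Field K] [AddCommGroup V] [Module K V] {T : α → Module.End K V}

theorem sq_sub_self_dvd_pow_sq_sub_pow {R : Type*} [CommRing R] (y : R) {n : ℕ} (hn : n ≠ 0) :
    y ^ 2 - y ∣ (y ^ n) ^ 2 - y ^ n := by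
  obtain ⟨n, rfl⟩ := Nat.exists_eq_add_one_of_ne_zero hn
  have h1 : y - 1 ∣ y ^ (n + 1) - 1 := sub_one_dvd_pow_sub_one y (n + 1)
  have h2 : y ∣ y ^ (n + 1) := dvd_pow_self y (Nat.succ_ne_zero n)
  have := mul_dvd_mul h2 h1
  convert this using 1 <;> ring

theorem pow_sub_pow_dvd_pow_sq_sub_pow {R : Type*} [CommRing R] (x : R) {p d n : ℕ} (hn : p ≤ n)
    (hd : d ∣ n) : x ^ (p + d) - x ^ p ∣ (x ^ n) ^ 2 - x ^ n := by
  have h1 : x ^ d - 1 ∣ x ^ n - 1 := by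
    obtain ⟨e, rfl⟩ := hd
    rw [pow_mul]
    exact sub_one_dvd_pow_sub_one _ _
  have h2 : x ^ p ∣ x ^ n := pow_dvd_pow _ hn
  have := mul_dvd_mul h2 h1
  convert this using 1 <;> ring

open Polynomial in
-- Between consecutive layers only finitely many operators occur, so the powers of `u` are
-- eventually periodic there and some power is idempotent. The relations of the successive layers
-- are multiplied together.
theorem exists_pow_idempotent_on_iterate [FiniteDimensional K V] (u : List α) (l : ℕ) :
    ∃ N : ℕ, N ≠ 0 ∧ ∃ e : ℕ, ∀ v ∈ (finMod T)^[l] (⊥ : Submodule K V),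
      (aeval (act T u) (((X ^ N) ^ 2 - X ^ N) ^ e : K[X])) v = 0 := by
  induction l with
  | zero => exact ⟨1, one_ne_zero, 0, fun v hv => by simpa using hv⟩
  | succ l ih =>
    obtain ⟨N, hN, e, he⟩ := ih
    rw [Function.iterate_succ_apply']
    set U := (finMod T)^[l] (⊥ : Submodule K V)
    let g (n : ℕ) := U.mkQ ∘ₗ (act T u ^ (n + 1)) ∘ₗ (finMod T U).subtype
    have hg : (Set.range g).Finite := by
      refine (finite_range_layer (T := T) U).subset ?_
      rintro _ ⟨n, rfl⟩
      exact ⟨(List.replicate (n + 1) u).flatten, by simp only [g, act_replicate]⟩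
    obtain ⟨p, q, hpq, h⟩ : ∃ p q, p < q ∧ g p = g q := by
      by_contra! H
      refine Set.infinite_range_of_injective (fun a b hab => ?_) hg
      rcases lt_trichotomy a b with h | h | h
      · exact absurd hab (H _ _ h)
      · exact h
      · exact absurd hab.symm (H _ _ h)
    obtain ⟨d, rfl⟩ := Nat.exists_eq_add_of_lt hpq
    have hN' : N * ((p + 1) * (d + 1)) ≠ 0 := by positivity
    -- Being a multiple of `N` preserves the relation of the lower layers; the new layer needs an
    -- exponent at least the preperiod `p + 1` and divisible by the period `d + 1`.
    refine ⟨N * ((p + 1) * (d + 1)), hN', e + 1, fun v hv => ?_⟩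
    set M := N * ((p + 1) * (d + 1)) with hM
    have h1 : (X ^ N) ^ 2 - X ^ N ∣ ((X ^ M) ^ 2 - X ^ M : K[X]) := by
      rw [hM, pow_mul X N]
      exact sq_sub_self_dvd_pow_sq_sub_pow _ (by positivity)
    have h2 : X ^ (p + 1 + (d + 1)) - X ^ (p + 1) ∣ ((X ^ M) ^ 2 - X ^ M : K[X]) := by
      refine pow_sub_pow_dvd_pow_sq_sub_pow _ ?_ ⟨N * (p + 1), by rw [hM]; ring⟩
      rw [hM, mul_left_comm]
      exact Nat.le_mul_of_pos_right _ (by positivity)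
    obtain ⟨s, hs⟩ := mul_dvd_mul (pow_dvd_pow_of_dvd h1 e) h2
    rw [pow_succ, hs, mul_comm _ s, aeval_mul, aeval_mul, Module.End.mul_apply,
      Module.End.mul_apply, he, map_zero]
    have := layer_eq h.symm hv
    simp only [map_sub, map_pow, aeval_X, LinearMap.sub_apply]
    convert this using 4
    omega

open Polynomial in
/-- If `e ^ 2 - e` is nilpotent, then `n ↦ e ^ n` is eventually polynomial. -/
theorem exists_pow_eq_sum_pow_smul [CharZero K] {A : Type*} [Ring A] [Algebra K A] {e : A} {l : ℕ}
    (he : (e ^ 2 - e) ^ l = 0) :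
    ∃ (D : ℕ) (c : ℕ → A), ∀ t : ℕ, e ^ (l + t) = ∑ i ∈ Finset.range D, (t : K) ^ i • c i := by
  -- After multiplication by `e ^ l`, the binomial expansion of `e ^ t` in powers of `e - 1` keeps
  -- only the terms `i < l`, whose binomial coefficients are polynomials in `t`.
  have hvan : ∀ i, l ≤ i → e ^ l * (e - 1) ^ i = 0 := by
    intro i hi
    have hcomm : Commute e (e - 1) := (Commute.refl e).sub_right (Commute.one_right e)
    have : e ^ 2 - e = e * (e - 1) := by rw [mul_sub, mul_one, pow_two]
    rw [this, hcomm.mul_pow] at he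
    obtain ⟨j, rfl⟩ := Nat.exists_eq_add_of_le hi
    rw [pow_add, ← mul_assoc, he, zero_mul]
  let P (i : ℕ) : K[X] := C ((i.factorial : K)⁻¹) * descPochhammer K i
  have hP (i t : ℕ) : (P i).eval (t : K) = (t.choose i : K) := by
    have hi : (i.factorial : K) ≠ 0 := by exact_mod_cast i.factorial_ne_zero
    simp only [P, eval_mul, eval_C]
    rw [descPochhammer_eval_eq_descFactorial, Nat.descFactorial_eq_factorial_mul_choose]
    push_cast
    field_simp
  let D := (Finset.range l).sup (fun i => (P i).natDegree) + 1
  refine ⟨D, fun j => ∑ i ∈ Finset.range l, (P i).coeff j • (e ^ l * (e - 1) ^ i), fun t => ?_⟩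
  have h1 : e ^ (l + t) = ∑ i ∈ Finset.range l, (t.choose i : K) • (e ^ l * (e - 1) ^ i) := by
    have hb : e ^ t = ∑ i ∈ Finset.range (t + 1), (e - 1) ^ i * (t.choose i : A) := by
      conv_lhs => rw [← sub_add_cancel e 1, (Commute.one_right (e - 1)).add_pow]
      simp
    rw [pow_add, hb, Finset.mul_sum]
    have hterm : ∀ i, e ^ l * ((e - 1) ^ i * (t.choose i : A)) =
        (t.choose i : K) • (e ^ l * (e - 1) ^ i) := by
      intro i
      rw [Nat.cast_smul_eq_nsmul, nsmul_eq_mul, ← mul_assoc, Nat.cast_comm]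
    simp only [hterm]
    have ext1 : ∀ n m : ℕ, n ≤ m → (∀ i, n ≤ i → i < m →
        (t.choose i : K) • (e ^ l * (e - 1) ^ i) = 0) →
        ∑ i ∈ Finset.range n, (t.choose i : K) • (e ^ l * (e - 1) ^ i) =
        ∑ i ∈ Finset.range m, (t.choose i : K) • (e ^ l * (e - 1) ^ i) := by
      intro n m hnm h
      refine Finset.sum_subset (Finset.range_mono hnm) fun i hi hi' => ?_
      exact h i (by simpa using hi') (by simpa using hi)
    rw [ext1 (t + 1) (max (t + 1) l) (le_max_left _ _), ext1 l (max (t + 1) l) (le_max_right _ _)]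
    · intro i hi _
      rw [hvan i hi, smul_zero]
    · intro i hi _
      rw [Nat.choose_eq_zero_of_lt hi]
      simp
  rw [h1]
  simp only [Finset.smul_sum, smul_smul]
  rw [Finset.sum_comm]
  refine Finset.sum_congr rfl fun i hi => ?_
  rw [← Finset.sum_smul, ← hP, eval_eq_sum_range' (n := D)]
  · simp only [mul_comm]
  · exact Nat.lt_succ_of_le (Finset.le_sup (f := fun i => (P i).natDegree) hi)

end Pumping

/-! ### Polynomial curves leaving a layer -/

section Pumping

variable {α K V : Type*} [Field K] [AddCommGroup V] [Module K V] {T : α → Module.End K V}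

theorem finite_range_of_eventually_periodic {β : Type*} (g : ℕ → β) {a N : ℕ} (hN : N ≠ 0)
    (h : ∀ n, a ≤ n → g (n + N) = g n) : (Set.range g).Finite := by
  refine ((Set.finite_lt_nat (a + N)).image g).subset ?_
  rintro _ ⟨n, rfl⟩
  induction n using Nat.strong_induction_on with
  | _ n ih =>
    by_cases hn : n < a + N
    · exact ⟨n, hn, rfl⟩
    · obtain ⟨m, rfl⟩ := Nat.exists_eq_add_of_le' (show N ≤ n by omega)
      rw [h m (by omega)]
      exact ih m (by omega)

/-- A vector outside the next layer is moved, by the powers of some word, along a non-constant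
polynomial curve modulo the current layer. -/
theorem exists_polynomial_pump [Finite α] [FiniteDimensional K V] [CharZero K] {l : ℕ}
    (htop : (finMod T)^[l] (⊥ : Submodule K V) = ⊤) (j : ℕ) {z : V}
    (hz : z ∉ (finMod T)^[j + 1] (⊥ : Submodule K V)) :
    ∃ (p q : List α) (D : ℕ) (c : ℕ → Module.End K V),
      (∀ t : ℕ, act T (p ++ (List.replicate t q).flatten) =
        ∑ i ∈ Finset.range D, (t : K) ^ i • c i) ∧
      ∃ i, 1 ≤ i ∧ i < D ∧ c i z ∉ (finMod T)^[j] (⊥ : Submodule K V) := by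
  have hU : IsInvariant T ((finMod T)^[j] (⊥ : Submodule K V)) :=
    isInvariant_iterate isInvariant_bot j
  rw [Function.iterate_succ_apply'] at hz
  set U := (finMod T)^[j] (⊥ : Submodule K V) with hUdef
  have hzl : z ∈ (finMod T)^[l] U := by
    have h := iterate_mono (T := T) (U := (⊥ : Submodule K V)) isInvariant_bot
      (Nat.le_add_right l j)
    simp only [htop, Function.iterate_add_apply, ← hUdef] at h
    exact h trivial
  have htor : z ∉ torMod T U := fun h => hz (mem_finMod_of_torMod hU l hzl h)
  obtain ⟨β, u, hβ⟩ : ∃ β u : List α,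
      ¬ (Set.range fun n : ℕ => U.mkQ ((act T u ^ n) (act T β z))).Finite := by
    by_contra! H
    exact htor H
  obtain ⟨N, hN, e, he⟩ := exists_pow_idempotent_on_iterate (T := T) u l
  have hnil : ((act T u ^ N) ^ 2 - act T u ^ N) ^ e = 0 := by
    ext v
    have := he v (htop ▸ trivial)
    simpa only [map_pow, map_sub, Polynomial.aeval_X, LinearMap.zero_apply] using this
  obtain ⟨D, c, hc⟩ := exists_pow_eq_sum_pow_smul (K := K) hnil
  refine ⟨β ++ (List.replicate (N * e) u).flatten, (List.replicate N u).flatten, D,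
    fun i => c i * act T β, fun t => ?_, ?_⟩
  · simp only [act_append, act_replicate]
    rw [← mul_assoc, pow_mul, ← pow_add, add_comm, hc, Finset.sum_mul]
    exact Finset.sum_congr rfl fun i _ => smul_mul_assoc _ _ _
  · by_contra! H
    apply hβ
    -- If all nonconstant coefficients fell into `U`, the powers of `u` would be periodic modulo `U`
    -- with period `N` from `N * e` on, so their orbit would be finite.
    have hconst (t : ℕ) : U.mkQ ((act T u ^ (N * (e + t))) (act T β z)) =
        U.mkQ ((act T u ^ (N * e)) (act T β z)) := by
      have h1 (t : ℕ) : U.mkQ ((act T u ^ (N * (e + t))) (act T β z)) =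
          ∑ i ∈ Finset.range D, (t : K) ^ i • U.mkQ (c i (act T β z)) := by
        rw [pow_mul, hc]
        simp
      have h0 := h1 0
      rw [add_zero] at h0
      rw [h0, h1]
      refine Finset.sum_congr rfl fun i hi => ?_
      rcases Nat.eq_zero_or_pos i with rfl | hpos
      · simp
      · have : U.mkQ (c i (act T β z)) = 0 := by
          simpa using H i hpos (by simpa using hi)
        rw [this, smul_zero, smul_zero]
    refine finite_range_of_eventually_periodic _ (a := N * e) hN fun n hn => ?_
    obtain ⟨r, rfl⟩ := Nat.exists_eq_add_of_le' hn
    have h1 := mkQ_eq_iff.1 (hconst 1)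
    have h2 := hU.act_mem (List.replicate r u).flatten h1
    rw [act_replicate, map_sub] at h2
    refine mkQ_eq_iff.2 ?_
    rw [add_assoc, pow_add, pow_add _ r (N * e)]
    simpa only [Module.End.mul_apply, mul_add, mul_one] using h2

open Polynomial in
/-- The coefficients of a vector polynomial with values in `U` lie in `U`. -/
theorem coeff_mem_of_forall_sum_pow_mem [CharZero K] {ι : Type*} {U : Submodule K V}
    (s : Finset ι) (e : ι → ℕ) (he : Set.InjOn e s) (y : ι → V)
    (h : ∀ n : ℕ, ∑ p ∈ s, (n : K) ^ e p • y p ∈ U) : ∀ p ∈ s, y p ∈ U := by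
  intro p hp
  by_contra hyp
  obtain ⟨ψ, hψ, hle⟩ := Submodule.exists_le_ker_of_notMem hyp
  let P : K[X] := ∑ p ∈ s, C (ψ (y p)) * X ^ e p
  have hP : P = 0 := by
    refine eq_zero_of_infinite_isRoot _ ((Set.infinite_range_of_injective
      (Nat.cast_injective (R := K))).mono ?_)
    rintro _ ⟨n, rfl⟩
    have := hle (h n)
    simp only [LinearMap.mem_ker, map_sum, map_smul, smul_eq_mul] at this
    simp only [P, Set.mem_ofPred_eq, IsRoot.def, eval_finsetSum, eval_mul, eval_C, eval_pow, eval_X]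
    rw [← this]
    exact Finset.sum_congr rfl fun i _ => mul_comm _ _
  have hcoeff : P.coeff (e p) = ψ (y p) := by
    simp only [P, finsetSum_coeff, coeff_C_mul, coeff_X_pow]
    rw [Finset.sum_eq_single_of_mem p hp]
    · simp
    · intro b hb hbp
      rw [if_neg fun hh => hbp (he hb hp hh.symm), mul_zero]
  rw [hP, coeff_zero] at hcoeff
  exact hψ hcoeff.symm

/-- A vector outside the `(k + j)`-th layer is moved, along words of linearly growing length,
along a polynomial curve of degree at least `k` modulo the `j`-th layer. -/
theorem exists_polynomial_curve [Finite α] [FiniteDimensional K V] [CharZero K] {l : ℕ}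
    (htop : (finMod T)^[l] (⊥ : Submodule K V) = ⊤) (k j : ℕ) {v : V}
    (hv : v ∉ (finMod T)^[k + j] (⊥ : Submodule K V)) :
    ∃ (w : ℕ → List α) (C d : ℕ) (z : ℕ → V), (∀ t, (w t).length ≤ C * (t + 1)) ∧
      (∀ t : ℕ, act T (w t) v = ∑ i ∈ Finset.range d, (t : K) ^ i • z i) ∧
      ∃ i, k ≤ i ∧ i < d ∧ z i ∉ (finMod T)^[j] (⊥ : Submodule K V) := by
  induction k generalizing j with
  | zero =>
    rw [zero_add] at hv
    exact ⟨fun _ => [], 0, 1, fun _ => v, by simp, by simp, 0, le_rfl, one_pos, hv⟩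
  | succ k ih =>
    obtain ⟨w, C, d, z, hlen, hw, i₀, hk, hd, hz⟩ := ih (j + 1) (by rwa [add_right_comm] at hv)
    obtain ⟨p, q, D, c, hc, a₀, ha, hD, hcz⟩ := exists_polynomial_pump htop j hz
    set U := (finMod T)^[j] (⊥ : Submodule K V) with hU
    let S : Finset (ℕ × ℕ) := Finset.range D ×ˢ Finset.range d
    let y (s e : ℕ) : V := ∑ x ∈ S with x.1 + x.2 = e, (s : K) ^ x.1 • c x.1 (z x.2)
    -- Running the new pump `s * t` times makes `y s e` the coefficient of `t ^ e`. Terms of equal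
    -- total degree may cancel for one slope `s` but not for all: the coefficient of `s ^ a₀` in `y
    -- s (a₀ + i₀)` is `c a₀ (z i₀)`.
    obtain ⟨s, hs⟩ : ∃ s : ℕ, y s (a₀ + i₀) ∉ U := by
      by_contra! H
      refine hcz (coeff_mem_of_forall_sum_pow_mem (U := U) {x ∈ S | x.1 + x.2 = a₀ + i₀} Prod.fst
        ?_ (fun x => c x.1 (z x.2)) H (a₀, i₀) ?_)
      · rintro ⟨x1, x2⟩ hx ⟨y1, y2⟩ hy h
        simp only [Finset.coe_filter, Set.mem_ofPred_eq] at hx hy h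
        ext
        · exact h
        · simp only
          omega
      · simp [S, hD, hd]
    refine ⟨fun t => w t ++ (p ++ (List.replicate (s * t) q).flatten),
      C + p.length + s * q.length, D + d, y s, fun t => ?_, fun t => ?_,
      a₀ + i₀, by omega, by omega, hs⟩
    · have := hlen t
      simp only [List.length_append, List.length_flatten, List.map_replicate, List.sum_replicate,
        smul_eq_mul]
      nlinarith [Nat.zero_le (p.length * t), Nat.zero_le (s * q.length)]
    · rw [act_append, Module.End.mul_apply, hw, hc, map_sum]
      simp only [LinearMap.sum_apply, map_smul, LinearMap.smul_apply, Finset.smul_sum, y]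
      rw [Finset.sum_comm, ← Finset.sum_product', ← Finset.sum_fiberwise_of_maps_to
        (g := fun x : ℕ × ℕ => x.1 + x.2) (t := Finset.range (D + d))]
      · refine Finset.sum_congr rfl fun e _ => Finset.sum_congr rfl fun x hx => ?_
        rw [Finset.mem_filter] at hx
        rw [← hx.2, smul_smul, smul_smul]
        push_cast
        congr 1
        ring
      · intro x hx
        simp only [Finset.mem_product, Finset.mem_range] at hx ⊢
        omega

end Pumping

/-! ### Finitely many traces force the layers to exhaust the space -/

section Trace

variable {α K V : Type*} [Field K] [AddCommGroup V] [Module K V]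

open Polynomial in
/-- In characteristic zero an endomorphism is nilpotent if its positive powers have trace zero. -/
theorem isNilpotent_of_forall_trace_pow_eq_zero [CharZero K] [FiniteDimensional K V]
    {x : Module.End K V} (hx : ∀ n : ℕ, LinearMap.trace K V (x ^ (n + 1)) = 0) :
    IsNilpotent x := by
  have hmin : minpoly K x ≠ 0 := minpoly.ne_zero (Algebra.IsIntegral.isIntegral x)
  obtain ⟨q, hq, hq'⟩ := Polynomial.exists_eq_pow_rootMultiplicity_mul_and_not_dvd _ hmin 0
  set a := (minpoly K x).rootMultiplicity 0
  rw [C_0, sub_zero] at hq hq'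
  have hcop : IsCoprime (X ^ (a + 1)) q :=
    (((Polynomial.irreducible_X (R := K)).coprime_iff_not_dvd).2 hq').pow_left
  obtain ⟨u, v, huv⟩ := hcop
  have hzero : aeval x (X ^ a * q) = 0 := by rw [← hq, minpoly.aeval]
  have hp (p : K[X]) : LinearMap.trace K V (aeval x (p * X)) = 0 := by
    rw [aeval_eq_sum_range, map_sum]
    refine Finset.sum_eq_zero fun i _ => ?_
    rw [map_smul]
    cases i with
    | zero => simp
    | succ i => rw [hx, smul_zero]
  -- This is the projection onto the part where `x` is invertible. As a polynomial in `x` without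
  -- constant term it has trace zero, so in characteristic zero it vanishes.
  have hidem : IsIdempotentElem (aeval x (u * X ^ (a + 1))) := by
    rw [IsIdempotentElem, ← sub_eq_zero, ← map_mul, ← map_sub]
    have : u * X ^ (a + 1) * (u * X ^ (a + 1)) - u * X ^ (a + 1) =
        -(u * v * X) * (X ^ a * q) := by
      linear_combination (u * X ^ (a + 1)) * huv
    rw [this, map_mul, hzero, mul_zero]
  have he := LinearMap.IsIdempotentElem.eq_zero_of_trace_eq_zero hidem (by rw [pow_succ, ← mul_assoc]; exact hp _)
  refine ⟨a, ?_⟩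
  have h1 : aeval x (X ^ a * (u * X ^ (a + 1) + v * q)) = x ^ a := by
    rw [huv, mul_one, map_pow, aeval_X]
  have h2 : X ^ a * (u * X ^ (a + 1) + v * q) = X ^ a * (u * X ^ (a + 1)) + v * (X ^ a * q) := by
    ring
  rw [← h1, h2, map_add, map_mul _ (X ^ a), he, map_mul _ v, hzero, mul_zero, mul_zero, add_zero]

variable {T : α → Module.End K V}

/-- The span of the operators attached to words. -/
def actSpan (T : α → Module.End K V) : Submodule K (Module.End K V) :=
  Submodule.span K (Set.range (act T))

theorem act_mem_actSpan (w : List α) : act T w ∈ actSpan T :=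
  Submodule.subset_span ⟨w, rfl⟩

theorem act_mul_mem_actSpan (w : List α) {x : Module.End K V} (hx : x ∈ actSpan T) :
    act T w * x ∈ actSpan T := by
  induction hx using Submodule.span_induction with
  | mem x hx =>
    obtain ⟨s, rfl⟩ := hx
    rw [← act_append]
    exact act_mem_actSpan _
  | zero => simp
  | add x y _ _ hx hy => simpa [mul_add] using (actSpan T).add_mem hx hy
  | smul c x _ hx => simpa using (actSpan T).smul_mem c hx

theorem mul_mem_actSpan {x y : Module.End K V} (hx : x ∈ actSpan T) (hy : y ∈ actSpan T) :
    x * y ∈ actSpan T := by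
  induction hx using Submodule.span_induction with
  | mem x hx =>
    obtain ⟨s, rfl⟩ := hx
    exact act_mul_mem_actSpan s hy
  | zero => simp
  | add x z _ _ hx hz => simpa [add_mul] using (actSpan T).add_mem hx hz
  | smul c x _ hx => simpa using (actSpan T).smul_mem c hx

theorem IsInvariant.actSpan_mem {U : Submodule K V} (hU : IsInvariant T U) {x : Module.End K V}
    (hx : x ∈ actSpan T) {v : V} (hv : v ∈ U) : x v ∈ U := by
  induction hx using Submodule.span_induction with
  | mem x hx =>
    obtain ⟨s, rfl⟩ := hx
    exact hU.act_mem s hv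
  | zero => simp
  | add x z _ _ hx hz => simpa using U.add_mem hx hz
  | smul c x _ hx => simpa using U.smul_mem c hx

/-- The radical of the trace form on `actSpan T`. -/
def traceRadical (T : α → Module.End K V) : Submodule K (Module.End K V) where
  carrier := {x | x ∈ actSpan T ∧ ∀ w, LinearMap.trace K V (x * act T w) = 0}
  zero_mem' := ⟨zero_mem _, by simp⟩
  add_mem' := fun hx hy => ⟨add_mem hx.1 hy.1, fun w => by
    rw [add_mul, map_add, hx.2, hy.2, add_zero]⟩
  smul_mem' := fun c x hx => ⟨Submodule.smul_mem _ c hx.1, fun w => by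
    rw [smul_mul_assoc, map_smul, hx.2, smul_zero]⟩

theorem act_mul_mem_traceRadical (w : List α) {x : Module.End K V} (hx : x ∈ traceRadical T) :
    act T w * x ∈ traceRadical T := by
  refine ⟨act_mul_mem_actSpan w hx.1, fun s => ?_⟩
  rw [mul_assoc, LinearMap.trace_mul_comm, mul_assoc, ← act_append]
  exact hx.2 _

theorem trace_mul_eq_zero {x y : Module.End K V} (hx : x ∈ traceRadical T) (hy : y ∈ actSpan T) :
    LinearMap.trace K V (x * y) = 0 := by
  induction hy using Submodule.span_induction with
  | mem y hy =>
    obtain ⟨s, rfl⟩ := hy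
    exact hx.2 s
  | zero => simp
  | add y z _ _ hy hz => rw [mul_add, map_add, hy, hz, add_zero]
  | smul c y _ hy => rw [mul_smul_comm, map_smul, hy, smul_zero]

theorem isNilpotent_of_mem_traceRadical [CharZero K] [FiniteDimensional K V]
    {x : Module.End K V} (hx : x ∈ traceRadical T) : IsNilpotent x := by
  have hpow (n : ℕ) : x ^ n ∈ actSpan T := by
    induction n with
    | zero => exact act_mem_actSpan []
    | succ n ih =>
      rw [pow_succ]
      exact mul_mem_actSpan ih hx.1
  refine isNilpotent_of_forall_trace_pow_eq_zero fun n => ?_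
  rw [pow_succ']
  exact trace_mul_eq_zero hx (hpow n)

/-- Take `v` outside `U` in a minimal invariant `W` above `U`. If the radical moved `v` out of `U`,
minimality would give `v` congruent to `y v` modulo `U` with `y` in the radical, and iterating would
contradict nilpotency of `y`. -/
theorem exists_traceRadical_apply_mem [CharZero K] [FiniteDimensional K V] {U : Submodule K V}
    (hU : IsInvariant T U) (hne : U ≠ ⊤) :
    ∃ v, v ∉ U ∧ ∀ x ∈ traceRadical T, x v ∈ U := by
  obtain ⟨W, ⟨hUW, hW⟩, hmin⟩ := wellFounded_lt.has_min
    {W : Submodule K V | U < W ∧ IsInvariant T W} ⟨⊤, hne.lt_top, fun _ _ _ => trivial⟩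
  obtain ⟨v, hvW, hvU⟩ := SetLike.exists_of_lt hUW
  refine ⟨v, hvU, fun x hx => ?_⟩
  by_contra hxv
  let E : Module.End K V →ₗ[K] V := LinearMap.applyₗ v
  let W' := U ⊔ (traceRadical T).map E
  have hEmem {x} (hx : x ∈ traceRadical T) : x v ∈ (traceRadical T).map E := ⟨x, hx, rfl⟩
  have hW'W : W' ≤ W := by
    refine sup_le hUW.le ?_
    rintro _ ⟨y, hy, rfl⟩
    exact hW.actSpan_mem hy.1 hvW
  have hW' : IsInvariant T W' := by
    intro a z hz
    obtain ⟨p, hp, _, ⟨y, hy, rfl⟩, rfl⟩ := Submodule.mem_sup.1 hz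
    rw [map_add]
    refine add_mem (Submodule.mem_sup_left (hU a p hp)) (Submodule.mem_sup_right ?_)
    have := act_mul_mem_traceRadical [a] hy
    exact hEmem (by simpa [act_cons] using this)
  have hUW' : U < W' := by
    refine lt_of_le_of_ne le_sup_left fun h => hxv ?_
    rw [h]
    exact Submodule.mem_sup_right (hEmem hx)
  have hWW' : W' = W := by
    by_contra hne
    exact hmin W' ⟨hUW', hW'⟩ (lt_of_le_of_ne hW'W hne)
  rw [← hWW'] at hvW
  obtain ⟨p, hp, _, ⟨y, hy, rfl⟩, hpy⟩ := Submodule.mem_sup.1 hvW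
  have hyv : v - y v ∈ U := by
    have : v - y v = p := by
      nth_rewrite 1 [← hpy]
      exact add_sub_cancel_right _ _
    rwa [this]
  have hpow (n : ℕ) : v - (y ^ n) v ∈ U := by
    induction n with
    | zero => simp
    | succ n ih =>
      have := U.add_mem hyv (hU.actSpan_mem hy.1 ih)
      rw [map_sub, sub_add_sub_cancel] at this
      rwa [pow_succ']
  obtain ⟨n, hn⟩ := isNilpotent_of_mem_traceRadical hy
  have := hpow n
  rw [hn] at this
  exact hvU (by simpa using this)

/-- If the traces of the operators attached to words form a finite set, then every proper
invariant subspace is properly contained in the next layer above it. -/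
theorem lt_finMod [CharZero K] [FiniteDimensional K V]
    (htr : (Set.range fun w => LinearMap.trace K V (act T w)).Finite) {U : Submodule K V}
    (hU : IsInvariant T U) (hne : U ≠ ⊤) : U < finMod T U := by
  obtain ⟨v, hv, hI⟩ := exists_traceRadical_apply_mem hU hne
  refine lt_of_le_of_ne (le_finMod hU) fun h => hv ?_
  rw [h]
  obtain ⟨t, ht, htspan⟩ := (Submodule.fg_span_iff_fg_span_finset_subset (Set.range (act T))).1
    (IsNoetherian.noetherian (actSpan T))
  choose! b hb using fun y (hy : y ∈ t) => ht hy
  have hfin : (Set.range fun (s : List α) (y : t) =>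
      LinearMap.trace K V (act T s * act T (b y))).Finite := by
    refine (Set.Finite.pi fun _ : t => htr).subset ?_
    rintro _ ⟨s, rfl⟩ y -
    exact ⟨b y ++ s, by simp only [act_append]⟩
  -- The finitely many trace vectors against the spanning set `t` determine a word up to the
  -- radical, and the radical sends `v` into `U`.
  refine mem_finMod.2 (finite_range_of_factor hfin fun s s' hs => mkQ_eq_iff.2 ?_)
  rw [← LinearMap.sub_apply]
  refine hI _ ⟨sub_mem (act_mem_actSpan s) (act_mem_actSpan s'), fun w => ?_⟩
  have hw : act T w ∈ Submodule.span K (t : Set (Module.End K V)) := by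
    rw [← htspan]
    exact act_mem_actSpan w
  generalize act T w = y at hw ⊢
  induction hw using Submodule.span_induction with
  | mem y hy =>
    have := congrFun hs ⟨y, hy⟩
    simp only [hb y hy] at this
    rw [sub_mul, map_sub, this, sub_self]
  | zero => simp
  | add y z _ _ hy hz => rw [mul_add, map_add, hy, hz, add_zero]
  | smul c y _ hy => rw [mul_smul_comm, map_smul, hy, smul_zero]

theorem exists_iterate_finMod_eq_top [CharZero K] [FiniteDimensional K V]
    (htr : (Set.range fun w => LinearMap.trace K V (act T w)).Finite) :
    ∃ l : ℕ, (finMod T)^[l] (⊥ : Submodule K V) = ⊤ := by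
  obtain ⟨n, hn⟩ := monotone_stabilizes_iff_noetherian.2 (inferInstance : IsNoetherian K V)
    ⟨_, iterate_mono (T := T) (U := (⊥ : Submodule K V)) isInvariant_bot⟩
  refine ⟨n, ?_⟩
  by_contra hne
  have := lt_finMod htr (isInvariant_iterate isInvariant_bot n) hne
  rw [← Function.iterate_succ_apply' (finMod T)] at this
  exact this.ne (hn (n + 1) n.le_succ)

end Trace

/-! ### Automata modulo a layer and polynomial upper bounds -/

section Automaton

universe v

variable {α K : Type*} {V : Type v} [Field K] [AddCommGroup V] [Module K V] {T : α → Module.End K V}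

/-- A vector with finite orbit modulo `U` is followed, up to elements of `U`, by a finite
automaton. -/
theorem exists_automaton {U : Submodule K V} {v : V} (hv : v ∈ finMod T U) :
    ∃ (Q : Type v) (_ : Fintype Q) (q₀ : Q) (δ : α → Q → Q) (r : Q → V),
      v - r q₀ ∈ U ∧ ∀ a q, T a (r q) - r (δ a q) ∈ U := by
  let f (w : List α) : V ⧸ U := U.mkQ (act T w v)
  have hf : (Set.range f).Finite := hv
  choose wd hwd using fun q : Set.range f => q.2
  refine ⟨Set.range f, hf.fintype, ⟨f [], [], rfl⟩, fun a q => ⟨f (wd q ++ [a]), _, rfl⟩,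
    fun q => act T (wd q) v, mkQ_eq_iff.1 ?_, fun a q => mkQ_eq_iff.1 ?_⟩
  · exact (hwd ⟨f [], [], rfl⟩).symm
  · have := hwd ⟨f (wd q ++ [a]), _, rfl⟩
    refine Eq.trans ?_ this.symm
    simp only [f, act_append, act_cons, act_nil, one_mul, Module.End.mul_apply]

end Automaton

section Growth

variable {α V : Type*} [Finite α] [AddCommGroup V] [Module ℚ V] {T : α → Module.End ℚ V}

/-- Each letter read replaces a representative by the next at the cost of an error in `U`, on which
the remaining word acts; the sum runs over the lengths of these remainders. -/
theorem exists_bound_of_mem_finMod (ψ : V →ₗ[ℚ] ℚ) {U : Submodule ℚ V} {B : ℕ → ℚ}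
    (hB : ∀ n, 0 ≤ B n)
    (hU : ∀ x ∈ U, ∃ C : ℚ, ∀ w : List α, |ψ (act T w x)| ≤ C * B w.length) {v : V}
    (hv : v ∈ finMod T U) :
    ∃ C : ℚ, ∀ w : List α, |ψ (act T w v)| ≤ C * (1 + ∑ i ∈ Finset.range (w.length + 1), B i) := by
  obtain ⟨Q, _, q₀, δ, r, h₀, hδ⟩ := exists_automaton hv
  have := Fintype.ofFinite α
  choose C₁ hC₁ using fun a q => hU _ (hδ a q)
  obtain ⟨C₂, hC₂⟩ := hU _ h₀
  obtain ⟨D, hD⟩ : ∃ D : ℚ, ∀ a q, C₁ a q ≤ D := by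
    obtain ⟨D, hD⟩ := (Set.finite_range fun p : α × Q => C₁ p.1 p.2).bddAbove
    exact ⟨D, fun a q => hD ⟨(a, q), rfl⟩⟩
  obtain ⟨E, hE⟩ : ∃ E : ℚ, ∀ q, |ψ (r q)| ≤ E := by
    obtain ⟨E, hE⟩ := (Set.finite_range fun q => |ψ (r q)|).bddAbove
    exact ⟨E, fun q => hE ⟨q, rfl⟩⟩
  have key (w : List α) (q : Q) :
      |ψ (act T w (r q))| ≤ E + D * ∑ i ∈ Finset.range w.length, B i := by
    induction w generalizing q with
    | nil => simpa using hE q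
    | cons a w ih =>
      have e : ψ (act T (a :: w) (r q)) =
          ψ (act T w (r (δ a q))) + ψ (act T w (T a (r q) - r (δ a q))) := by
        rw [act_cons, Module.End.mul_apply, ← map_add, ← map_add, add_sub_cancel]
      rw [e, List.length_cons, Finset.sum_range_succ, mul_add, ← add_assoc]
      refine (abs_add_le _ _).trans (add_le_add (ih _) ((hC₁ a q w).trans ?_))
      exact mul_le_mul_of_nonneg_right (hD a q) (hB _)
  refine ⟨|E| + |D| + |C₂|, fun w => ?_⟩
  have e : ψ (act T w v) = ψ (act T w (r q₀)) + ψ (act T w (v - r q₀)) := by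
    rw [← map_add, ← map_add, add_sub_cancel]
  rw [e]
  refine (abs_add_le _ _).trans ((add_le_add (key w q₀) (hC₂ w)).trans ?_)
  rw [Finset.sum_range_succ]
  have hS : 0 ≤ ∑ i ∈ Finset.range w.length, B i := Finset.sum_nonneg fun i _ => hB i
  have hb := hB w.length
  have h1 := le_abs_self E
  have h2 := mul_le_mul_of_nonneg_right (le_abs_self D) hS
  have h3 := mul_le_mul_of_nonneg_right (le_abs_self C₂) hb
  have h4 := mul_nonneg (abs_nonneg E) hS
  have h5 := mul_nonneg (abs_nonneg E) hb
  have h6 := mul_nonneg (abs_nonneg D) hb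
  have h7 := mul_nonneg (abs_nonneg C₂) hS
  nlinarith [abs_nonneg D, abs_nonneg C₂]

theorem exists_polynomial_bound (ψ : V →ₗ[ℚ] ℚ) (k : ℕ) {v : V}
    (hv : v ∈ (finMod T)^[k + 1] (⊥ : Submodule ℚ V)) :
    ∃ C : ℚ, ∀ w : List α, |ψ (act T w v)| ≤ C * ((w.length : ℚ) + 1) ^ k := by
  induction k generalizing v with
  | zero =>
    rw [Function.iterate_succ_apply'] at hv
    obtain ⟨C, hC⟩ := exists_bound_of_mem_finMod ψ (B := fun _ => 0) (fun _ => le_rfl)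
      (fun x hx => ⟨0, fun w => by simp [(Submodule.mem_bot ℚ).1 hx]⟩) hv
    exact ⟨C, fun w => by simpa using hC w⟩
  | succ k ih =>
    rw [Function.iterate_succ_apply'] at hv
    obtain ⟨C, hC⟩ := exists_bound_of_mem_finMod ψ (B := fun n => ((n : ℚ) + 1) ^ k)
      (fun n => by positivity) (fun x hx => ih hx) hv
    refine ⟨2 * |C|, fun w => (hC w).trans ?_⟩
    have hsum : ∑ i ∈ Finset.range (w.length + 1), ((i : ℚ) + 1) ^ k ≤
        ((w.length : ℚ) + 1) ^ (k + 1) := by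
      refine (Finset.sum_le_card_nsmul _ _ (((w.length : ℚ) + 1) ^ k) fun i hi => ?_).trans ?_
      · have : (i : ℚ) ≤ w.length := by
          exact_mod_cast Nat.lt_succ_iff.1 (Finset.mem_range.1 hi)
        gcongr
      · simp [pow_succ, mul_comm]
    have hone : (1 : ℚ) ≤ ((w.length : ℚ) + 1) ^ (k + 1) := one_le_pow₀ (by simp)
    calc C * (1 + ∑ i ∈ Finset.range (w.length + 1), ((i : ℚ) + 1) ^ k)
        ≤ |C| * (1 + ∑ i ∈ Finset.range (w.length + 1), ((i : ℚ) + 1) ^ k) :=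
          mul_le_mul_of_nonneg_right (le_abs_self C)
            (add_nonneg zero_le_one (Finset.sum_nonneg fun i _ => by positivity))
      _ ≤ |C| * (2 * ((w.length : ℚ) + 1) ^ (k + 1)) :=
          mul_le_mul_of_nonneg_left (by linarith) (abs_nonneg C)
      _ = _ := by ring

end Growth

/-! ### Matrix coefficients as convolutions of automatic series -/

section Convolution

variable {m : ℕ}

/-- Evaluation of a word series at a word. -/
def WordSeries.evalHom (w : List (Fin m)) : WordSeries m →+ ℂ where
  toFun f := f w
  map_zero' := rfl
  map_add' _ _ := rfl

theorem WordSeries.sum_apply {ι : Type*} (s : Finset ι) (f : ι → WordSeries m)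
    (w : List (Fin m)) : (∑ i ∈ s, f i) w = ∑ i ∈ s, f i w :=
  map_sum (WordSeries.evalHom w) f s

theorem isAutomatic_of_finite_range {f : List (Fin m) → ℂ}
    (hf : (Set.range fun (u : List (Fin m)) (w : List (Fin m)) => f (u ++ w)).Finite) :
    IsAutomatic ℂ f := by
  refine ⟨Submodule.fg_span hf, (hf.image fun g => g []).subset ?_⟩
  rintro _ ⟨u, rfl⟩
  exact ⟨_, ⟨u, rfl⟩, by simp⟩

theorem mem_R₀_of_finite_range {f : WordSeries m}
    (hf : (Set.range fun (u : List (Fin m)) (w : List (Fin m)) => f (u ++ w)).Finite) :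
    f ∈ R₀ m :=
  Algebra.subset_adjoin ⟨f, isAutomatic_of_finite_range hf, rfl⟩

/-- The indicator series of the words leading from the state `p` to the state `q`. -/
def pathSeries {Q : Type*} [DecidableEq Q] (δ : Fin m → Q → Q) (p q : Q) : WordSeries m :=
  fun w => if w.foldl (fun s a => δ a s) p = q then 1 else 0

theorem pathSeries_nil {Q : Type*} [DecidableEq Q] (δ : Fin m → Q → Q) (p q : Q) :
    pathSeries δ p q [] = if p = q then 1 else 0 := rfl

theorem shift_pathSeries {Q : Type*} [DecidableEq Q] (δ : Fin m → Q → Q) (p q : Q) (a : Fin m) :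
    WordSeries.shift a (pathSeries δ p q) = pathSeries δ (δ a p) q := rfl

theorem pathSeries_mem_R₀ {Q : Type*} [DecidableEq Q] [Finite Q] (δ : Fin m → Q → Q) (p q : Q) :
    pathSeries δ p q ∈ R₀ m := by
  refine mem_R₀_of_finite_range ((Set.finite_range fun s => pathSeries δ s q).subset ?_)
  rintro _ ⟨u, rfl⟩
  refine ⟨u.foldl (fun s a => δ a s) p, ?_⟩
  funext w
  simp [pathSeries]

/-- The indicator series of a one-letter word. -/
def letterSeries (a : Fin m) : WordSeries m := fun w => if w = [a] then 1 else 0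

theorem letterSeries_mem_R₀ (a : Fin m) : letterSeries a ∈ R₀ m := by
  refine mem_R₀_of_finite_range
    ((Set.toFinite {letterSeries a, (1 : WordSeries m), 0}).subset ?_)
  rintro _ ⟨u, rfl⟩
  match u with
  | [] => exact Or.inl rfl
  | [b] =>
    by_cases h : b = a
    · refine Or.inr (Or.inl ?_)
      funext w
      simp [letterSeries, WordSeries.one_apply, h]
    · refine Or.inr (Or.inr ?_)
      funext w
      simp [letterSeries, WordSeries.zero_apply, h]
  | b :: c :: u =>
    refine Or.inr (Or.inr ?_)
    funext w
    simp [letterSeries, WordSeries.zero_apply]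

theorem letterSeries_mul_cons (b a : Fin m) (h : WordSeries m) (w : List (Fin m)) :
    (letterSeries b * h) (a :: w) = if a = b then h w else 0 := by
  have hs : WordSeries.shift a (letterSeries b) = if a = b then 1 else 0 := by
    ext w
    split_ifs with hab
    · simp [WordSeries.shift, letterSeries, WordSeries.one_apply, hab]
    · simp [WordSeries.shift, letterSeries, WordSeries.zero_apply, hab]
  rw [WordSeries.mul_cons, hs]
  split_ifs with hab
  · simp [letterSeries]
  · rw [zero_mul]
    simp [letterSeries, WordSeries.zero_apply]

variable {V : Type*} [AddCommGroup V] [Module ℚ V]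

/-- The word series given by a vector and a functional. -/
def matrixCoeff (T : Fin m → Module.End ℚ V) (ψ : V →ₗ[ℚ] ℚ) (v : V) : WordSeries m :=
  fun w => ((ψ (act T w v) : ℚ) : ℂ)

variable {T : Fin m → Module.End ℚ V}

theorem matrixCoeff_add (ψ : V →ₗ[ℚ] ℚ) (x y : V) :
    matrixCoeff T ψ (x + y) = matrixCoeff T ψ x + matrixCoeff T ψ y := by
  ext w
  simp [matrixCoeff, WordSeries.add_apply]

/-- Telescoping along the run, read as a convolution: a word is cut into a path reaching `p`, the
letter producing an error there, and the rest acting on that error. -/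
theorem matrixCoeff_automaton {Q : Type*} [Fintype Q] [DecidableEq Q] (δ : Fin m → Q → Q)
    (r : Q → V) (ψ : V →ₗ[ℚ] ℚ) (q : Q) :
    matrixCoeff T ψ (r q) = ∑ p, ((ψ (r p) : ℚ) : ℂ) • pathSeries δ q p +
      ∑ p, pathSeries δ q p * ∑ a, letterSeries a * matrixCoeff T ψ (T a (r p) - r (δ a p)) := by
  ext w
  induction w generalizing q with
  | nil =>
    simp [WordSeries.add_apply, WordSeries.sum_apply, WordSeries.smul_apply, pathSeries_nil,
      WordSeries.mul_nil, letterSeries, matrixCoeff]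
  | cons a w ih =>
    have h1 : matrixCoeff T ψ (r q) (a :: w) = matrixCoeff T ψ (r (δ a q)) w +
        matrixCoeff T ψ (T a (r q) - r (δ a q)) w := by
      rw [← WordSeries.add_apply, ← matrixCoeff_add, add_sub_cancel]
      rfl
    have h2 (p : Q) : pathSeries δ q p (a :: w) = pathSeries δ (δ a q) p w := rfl
    rw [h1, ih]
    simp only [WordSeries.add_apply, WordSeries.sum_apply, WordSeries.smul_apply,
      WordSeries.mul_cons (pathSeries δ q _), letterSeries_mul_cons, shift_pathSeries, h2,
      pathSeries_nil, Finset.sum_add_distrib]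
    simp
    ring

theorem matrixCoeff_mem_R₀ (ψ : V →ₗ[ℚ] ℚ) (k : ℕ) {v : V}
    (hv : v ∈ (finMod T)^[k] (⊥ : Submodule ℚ V)) : matrixCoeff T ψ v ∈ R₀ m := by
  classical
  induction k generalizing v with
  | zero =>
    have : matrixCoeff T ψ v = 0 := by
      ext w
      simp [(Submodule.mem_bot ℚ).1 hv, matrixCoeff, WordSeries.zero_apply]
    rw [this]
    exact zero_mem _
  | succ k ih =>
    rw [Function.iterate_succ_apply'] at hv
    obtain ⟨Q, _, q₀, δ, r, h₀, hδ⟩ := exists_automaton hv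
    rw [← add_sub_cancel (r q₀) v, matrixCoeff_add, matrixCoeff_automaton δ]
    refine add_mem (add_mem ?_ ?_) (ih h₀)
    · exact sum_mem fun p _ => Subalgebra.smul_mem _ (pathSeries_mem_R₀ δ _ _) _
    · exact sum_mem fun p _ => mul_mem (pathSeries_mem_R₀ δ _ _)
        (sum_mem fun a _ => mul_mem (letterSeries_mem_R₀ a) (ih (hδ a p)))

/-- Generators are bounded, and a convolution has `w.length + 1` terms, so exponents `k` and `l`
combine to `k + l + 1`. -/
theorem exists_bound_of_mem_R₀ {f : WordSeries m} (hf : f ∈ R₀ m) :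
    ∃ (C : ℝ) (k : ℕ), ∀ w, ‖f w‖ ≤ C * ((w.length : ℝ) + 1) ^ k := by
  have mono {C : ℝ} (hC : 0 ≤ C) {k l : ℕ} (h : k ≤ l) (n : ℕ) :
      C * ((n : ℝ) + 1) ^ k ≤ C * ((n : ℝ) + 1) ^ l :=
    mul_le_mul_of_nonneg_left (pow_le_pow_right₀ (by simp) h) hC
  suffices h : ∃ (C : ℝ) (k : ℕ), 0 ≤ C ∧ ∀ w, ‖f w‖ ≤ C * ((w.length : ℝ) + 1) ^ k by
    obtain ⟨C, k, -, h⟩ := h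
    exact ⟨C, k, h⟩
  induction hf using Algebra.adjoin_induction with
  | mem f hf =>
    obtain ⟨f, ⟨-, hfin⟩, rfl⟩ := hf
    obtain ⟨C, hC⟩ := (hfin.image norm).bddAbove
    refine ⟨C, 0, (norm_nonneg _).trans (hC ⟨f [], ⟨[], rfl⟩, rfl⟩), fun w => ?_⟩
    rw [pow_zero, mul_one]
    exact hC ⟨f w, ⟨w, rfl⟩, rfl⟩
  | algebraMap c =>
    refine ⟨‖c‖, 0, norm_nonneg c, fun w => ?_⟩
    rw [Algebra.algebraMap_eq_smul_one, WordSeries.smul_apply, WordSeries.one_apply]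
    split_ifs <;> simp
  | add f g _ _ hf hg =>
    obtain ⟨C, k, hC, h⟩ := hf
    obtain ⟨D, l, hD, h'⟩ := hg
    refine ⟨C + D, max k l, add_nonneg hC hD, fun w => ?_⟩
    rw [WordSeries.add_apply, add_mul]
    exact (norm_add_le _ _).trans (add_le_add ((h w).trans (mono hC (le_max_left _ _) _))
      ((h' w).trans (mono hD (le_max_right _ _) _)))
  | mul f g _ _ hf hg =>
    obtain ⟨C, k, hC, h⟩ := hf
    obtain ⟨D, l, hD, h'⟩ := hg
    refine ⟨C * D, k + l + 1, mul_nonneg hC hD, fun w => ?_⟩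
    rw [WordSeries.mul_apply]
    refine (norm_sum_le _ _).trans ((Finset.sum_le_card_nsmul _ _
      (C * ((w.length : ℝ) + 1) ^ k * (D * ((w.length : ℝ) + 1) ^ l)) fun j hj => ?_).trans ?_)
    · rw [norm_mul]
      have hlen1 : ((w.take j).length : ℝ) ≤ w.length := by
        exact_mod_cast List.length_take_le' j w
      have hlen2 : ((w.drop j).length : ℝ) ≤ w.length := by
        exact_mod_cast (by simp : (w.drop j).length ≤ w.length)
      refine mul_le_mul ((h _).trans ?_) ((h' _).trans ?_) (norm_nonneg _) (by positivity)
      · gcongr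
      · gcongr
    · rw [Finset.card_range, nsmul_eq_mul]
      push_cast
      exact le_of_eq (by ring)

end Convolution

/-! ### Eigenvalue bounds and integrality of traces -/

section Eigenvalues

theorem le_one_of_forall_pow_le {r C : ℝ} {k : ℕ}
    (h : ∀ n : ℕ, r ^ n ≤ C * ((n : ℝ) + 1) ^ k) : r ≤ 1 := by
  by_contra! hr
  have ht := (tendsto_pow_const_div_const_pow_of_one_lt k hr).comp (Filter.tendsto_add_atTop_nat 1)
  have ht' := ht.const_mul (C * r)
  rw [mul_zero] at ht'
  obtain ⟨n, hn⟩ := (ht'.eventually_lt_const one_pos).exists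
  simp only [Function.comp_apply, Nat.cast_add, Nat.cast_one] at hn
  have hpos : 0 < r ^ n := by positivity
  have e : C * r * (((n : ℝ) + 1) ^ k / r ^ (n + 1)) = C * ((n : ℝ) + 1) ^ k / r ^ n := by
    rw [pow_succ]
    field_simp
  rw [e, div_lt_one hpos] at hn
  exact (h n).not_gt hn

/-- On an eigenvector the powers act by `μ ^ n`; one nonzero coordinate bounds `‖μ‖ ^ n`
polynomially. -/
theorem Matrix.norm_le_one_of_mem_spectrum {d : Type*} [Fintype d] [DecidableEq d]
    {M : Matrix d d ℂ} {k : ℕ}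
    (hM : ∀ i j, ∃ C : ℝ, ∀ n : ℕ, ‖(M ^ n) i j‖ ≤ C * ((n : ℝ) + 1) ^ k) {μ : ℂ}
    (hμ : μ ∈ spectrum ℂ M) : ‖μ‖ ≤ 1 := by
  rw [← Matrix.spectrum_toLin', ← Module.End.hasEigenvalue_iff_mem_spectrum] at hμ
  obtain ⟨x, hx⟩ := hμ.exists_hasEigenvector
  obtain ⟨i, hi⟩ := Function.ne_iff.1 hx.2
  choose C hC using hM
  have hpow (n : ℕ) : (M ^ n).mulVec x = μ ^ n • x := by
    have := hx.pow_apply n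
    rwa [← Matrix.toLin'_pow, Matrix.toLin'_apply] at this
  refine le_one_of_forall_pow_le (C := (∑ j, C i j * ‖x j‖) / ‖x i‖) (k := k) fun n => ?_
  have hxi : 0 < ‖x i‖ := norm_pos_iff.2 hi
  rw [div_mul_eq_mul_div, le_div_iff₀ hxi, ← norm_pow, ← norm_mul]
  have h := congrFun (hpow n) i
  simp only [Matrix.mulVec, dotProduct, Pi.smul_apply, smul_eq_mul] at h
  rw [← h, Finset.sum_mul]
  refine norm_sum_le_of_le _ fun j _ => ?_
  rw [norm_mul]
  have := mul_le_mul_of_nonneg_right (hC i j n) (norm_nonneg (x j))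
  linarith

theorem Matrix.norm_trace_le {d : Type*} [Fintype d] [DecidableEq d]
    {M : Matrix d d ℂ} (hM : ∀ μ ∈ spectrum ℂ M, ‖μ‖ ≤ 1) : ‖M.trace‖ ≤ Fintype.card d := by
  rw [Matrix.trace_eq_sum_roots_charpoly]
  refine (norm_multiset_sum_le _).trans ((Multiset.sum_le_card_nsmul _ 1 fun y hy => ?_).trans ?_)
  · obtain ⟨μ, hμ, rfl⟩ := Multiset.mem_map.1 hy
    exact hM μ (Matrix.mem_spectrum_iff_isRoot_charpoly.2 (Polynomial.isRoot_of_mem_roots hμ))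
  · rw [Multiset.card_map, nsmul_eq_mul, mul_one]
    have := Polynomial.card_roots' M.charpoly
    rw [Matrix.charpoly_natDegree_eq_dim] at this
    exact_mod_cast this

variable {V : Type*} [AddCommGroup V] [Module ℚ V]

theorem abs_trace_le_finrank [FiniteDimensional ℚ V] {φ : Module.End ℚ V} {k : ℕ}
    (hφ : ∀ (ψ : V →ₗ[ℚ] ℚ) (v : V), ∃ C : ℚ, ∀ n : ℕ, |ψ ((φ ^ n) v)| ≤ C * ((n : ℚ) + 1) ^ k) :
    |LinearMap.trace ℚ V φ| ≤ Module.finrank ℚ V := by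
  let b := Module.finBasis ℚ V
  let M := (LinearMap.toMatrixAlgEquiv b φ).map (algebraMap ℚ ℂ)
  have hM : ∀ i j, ∃ C : ℝ, ∀ n : ℕ, ‖(M ^ n) i j‖ ≤ C * ((n : ℝ) + 1) ^ k := by
    intro i j
    obtain ⟨C, hC⟩ := hφ (b.coord i) (b j)
    refine ⟨C, fun n => ?_⟩
    have e : (M ^ n) i j = ((b.coord i ((φ ^ n) (b j)) : ℚ) : ℂ) := by
      simp only [M]
      rw [← Matrix.map_pow, ← map_pow, Matrix.map_apply, LinearMap.toMatrixAlgEquiv_apply]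
      rfl
    rw [e, show ((b.coord i ((φ ^ n) (b j)) : ℚ) : ℂ) = ((b.coord i ((φ ^ n) (b j)) : ℝ) : ℂ) by
      push_cast; rfl, Complex.norm_real, Real.norm_eq_abs]
    exact_mod_cast hC n
  have h := Matrix.norm_trace_le fun μ hμ => Matrix.norm_le_one_of_mem_spectrum hM hμ
  have e : M.trace = ((LinearMap.trace ℚ V φ : ℚ) : ℂ) := by
    rw [LinearMap.trace_eq_matrix_trace ℚ b φ]
    simp only [M, Matrix.trace, Matrix.diag_apply, Matrix.map_apply, eq_ratCast]
    push_cast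
    rfl
  rw [e, show ((LinearMap.trace ℚ V φ : ℚ) : ℂ) = ((LinearMap.trace ℚ V φ : ℝ) : ℂ) by
    push_cast; rfl, Complex.norm_real, Real.norm_eq_abs, Fintype.card_fin] at h
  exact_mod_cast h

/-- An integral basis of the lattice is a rational basis of `V`, in which `φ` has an integer matrix.
-/
theorem exists_int_eq_trace (L : Submodule ℤ V) [Submodule.IsLattice ℚ L] {φ : Module.End ℚ V}
    (hφ : ∀ x ∈ L, φ x ∈ L) : ∃ n : ℤ, (n : ℚ) = LinearMap.trace ℚ V φ := by
  have : Module.Free ℤ L := inferInstance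
  let b := Module.Free.chooseBasis ℤ L
  let B := b.extendOfIsLattice ℚ
  refine ⟨∑ i, b.repr ⟨φ (b i), hφ _ (b i).2⟩ i, ?_⟩
  rw [LinearMap.trace_eq_matrix_trace ℚ B φ, Matrix.trace]
  push_cast
  refine Finset.sum_congr rfl fun i _ => ?_
  rw [Matrix.diag_apply, LinearMap.toMatrix_apply, Module.Basis.extendOfIsLattice_apply]
  have h : φ (b i) = ∑ j, ((b.repr ⟨φ (b i), hφ _ (b i).2⟩ j : ℤ) : ℚ) • B j := by
    have h1 := congrArg (Subtype.val) (b.sum_repr ⟨φ (b i), hφ _ (b i).2⟩)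
    simp only [Submodule.coe_sum, Submodule.coe_smul] at h1
    conv_lhs => rw [← h1]
    refine Finset.sum_congr rfl fun j _ => ?_
    rw [Module.Basis.extendOfIsLattice_apply, Int.cast_smul_eq_zsmul]
  conv_rhs => rw [h]
  rw [B.repr_sum_self]

end Eigenvalues

/-! ### Traces of words under polynomial growth -/

section Traces

variable {α V : Type*} [AddCommGroup V] [Module ℚ V] [FiniteDimensional ℚ V]
  {T : α → Module.End ℚ V}

/-- A polynomial bound for one matrix coefficient passes to all of them. -/
theorem exists_bound_matrix_coeff {v₀ : V} {ψ₀ : V →ₗ[ℚ] ℚ}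
    (hspan : Submodule.span ℚ (Set.range fun u => act T u v₀) = ⊤)
    (hsep : ∀ x, (∀ w, ψ₀ (act T w x) = 0) → x = 0) {C₀ : ℚ} {k : ℕ}
    (hC₀ : ∀ w : List α, |ψ₀ (act T w v₀)| ≤ C₀ * ((w.length : ℚ) + 1) ^ k)
    (ψ : V →ₗ[ℚ] ℚ) (v : V) :
    ∃ C : ℚ, 0 ≤ C ∧ ∀ w : List α, |ψ (act T w v)| ≤ C * ((w.length : ℚ) + 1) ^ k := by
  have hψ : ψ ∈ Submodule.span ℚ (Set.range fun s => ψ₀ ∘ₗ act T s) := by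
    -- By `hsep` the functionals `ψ₀ ∘ₗ act T s` have trivial common kernel, so they span the dual.
    refine FiniteDimensional.mem_span_of_iInf_ker_le_ker fun x hx => ?_
    rw [hsep x fun w => by simpa using (Submodule.mem_iInf _).1 hx w]
    exact zero_mem _
  have hv : v ∈ Submodule.span ℚ (Set.range fun u => act T u v₀) := hspan ▸ trivial
  induction hψ using Submodule.span_induction with
  | mem ψ hψ =>
    obtain ⟨s, rfl⟩ := hψ
    induction hv using Submodule.span_induction with
    | mem v hv =>
      obtain ⟨u, rfl⟩ := hv
      have hC : 0 ≤ C₀ := by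
        have := (abs_nonneg _).trans (hC₀ [])
        simpa using this
      refine ⟨C₀ * ((u.length : ℚ) + s.length + 1) ^ k, by positivity, fun w => ?_⟩
      have h := hC₀ (u ++ (w ++ s))
      simp only [act_append, Module.End.mul_apply] at h
      refine h.trans ?_
      rw [mul_assoc, ← mul_pow]
      gcongr
      simp only [List.length_append]
      push_cast
      nlinarith [Nat.cast_nonneg (α := ℚ) u.length, Nat.cast_nonneg (α := ℚ) w.length,
        Nat.cast_nonneg (α := ℚ) s.length]
    | zero => exact ⟨0, le_rfl, fun w => by simp⟩
    | add x y _ _ hx hy =>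
      obtain ⟨C, hC, h⟩ := hx
      obtain ⟨D, hD, h'⟩ := hy
      refine ⟨C + D, add_nonneg hC hD, fun w => ?_⟩
      rw [map_add, map_add, add_mul]
      exact (abs_add_le _ _).trans (add_le_add (h w) (h' w))
    | smul c x _ hx =>
      obtain ⟨C, hC, h⟩ := hx
      refine ⟨|c| * C, by positivity, fun w => ?_⟩
      rw [map_smul, map_smul, smul_eq_mul, abs_mul, mul_assoc]
      exact mul_le_mul_of_nonneg_left (h w) (abs_nonneg c)
  | zero => exact ⟨0, le_rfl, fun w => by simp⟩
  | add x y _ _ hx hy =>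
    obtain ⟨C, hC, h⟩ := hx
    obtain ⟨D, hD, h'⟩ := hy
    refine ⟨C + D, add_nonneg hC hD, fun w => ?_⟩
    rw [LinearMap.add_apply, add_mul]
    exact (abs_add_le _ _).trans (add_le_add (h w) (h' w))
  | smul c x _ hx =>
    obtain ⟨C, hC, h⟩ := hx
    refine ⟨|c| * C, by positivity, fun w => ?_⟩
    rw [LinearMap.smul_apply, smul_eq_mul, abs_mul, mul_assoc]
    exact mul_le_mul_of_nonneg_left (h w) (abs_nonneg c)

theorem finite_range_trace {v₀ : V} {ψ₀ : V →ₗ[ℚ] ℚ}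
    (hspan : Submodule.span ℚ (Set.range fun u => act T u v₀) = ⊤)
    (hfg : (Submodule.span ℤ (Set.range fun u => act T u v₀)).FG)
    (hsep : ∀ x, (∀ w, ψ₀ (act T w x) = 0) → x = 0) {C₀ : ℚ} {k : ℕ}
    (hC₀ : ∀ w : List α, |ψ₀ (act T w v₀)| ≤ C₀ * ((w.length : ℚ) + 1) ^ k) :
    (Set.range fun w => LinearMap.trace ℚ V (act T w)).Finite := by
  let L := Submodule.span ℤ (Set.range fun u => act T u v₀)
  have hL : Submodule.IsLattice ℚ L := ⟨hfg, by rw [Submodule.span_span_of_tower, hspan]⟩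
  have hinv (w : List α) : ∀ x ∈ L, act T w x ∈ L := by
    intro x hx
    induction hx using Submodule.span_induction with
    | mem x hx =>
      obtain ⟨u, rfl⟩ := hx
      rw [← Module.End.mul_apply, ← act_append]
      exact Submodule.subset_span ⟨_, rfl⟩
    | zero => simp
    | add x y _ _ hx hy => rw [map_add]; exact add_mem hx hy
    | smul c x _ hx => rw [map_zsmul]; exact Submodule.smul_mem _ _ hx
  refine ((Set.finite_Icc (-(Module.finrank ℚ V : ℤ)) (Module.finrank ℚ V)).image
    (fun n : ℤ => (n : ℚ))).subset ?_
  rintro _ ⟨w, rfl⟩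
  obtain ⟨n, hn⟩ := exists_int_eq_trace L (hinv w)
  refine ⟨n, ?_, hn⟩
  -- Powers of `w` are words of length linear in the exponent, so for fixed `w` all their matrix
  -- coefficients are polynomially bounded.
  have hb : |LinearMap.trace ℚ V (act T w)| ≤ Module.finrank ℚ V := by
    refine abs_trace_le_finrank (k := k) fun ψ v => ?_
    obtain ⟨C, hC, h⟩ := exists_bound_matrix_coeff hspan hsep hC₀ ψ v
    refine ⟨C * ((w.length : ℚ) + 1) ^ k, fun n => ?_⟩
    have := h (List.replicate n w).flatten
    rw [act_replicate] at this
    refine this.trans ?_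
    rw [mul_assoc, ← mul_pow]
    gcongr
    simp only [List.length_flatten, List.map_replicate, List.sum_replicate, smul_eq_mul]
    push_cast
    nlinarith [Nat.cast_nonneg (α := ℚ) n, Nat.cast_nonneg (α := ℚ) w.length]
  rw [← hn] at hb
  rw [Set.mem_Icc, ← abs_le]
  exact_mod_cast hb

end Traces

/-! ### The linear representation on the translates of `f` -/

section Representation

variable {α : Type*}

/-- The rational span of the translates of an integer-valued function on words. -/
def translateSpan (f : List α → ℤ) : Submodule ℚ (List α → ℚ) :=
  Submodule.span ℚ (Set.range fun (u w : List α) => (f (u ++ w) : ℚ))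

/-- The operator `g ↦ (w ↦ g (a w))` on all functions. -/
def translateOp (a : α) : Module.End ℚ (List α → ℚ) := LinearMap.funLeft ℚ ℚ (List.cons a)

theorem translateOp_mem (f : List α → ℤ) (a : α) :
    ∀ g ∈ translateSpan f, translateOp a g ∈ translateSpan f := by
  intro g hg
  induction hg using Submodule.span_induction with
  | mem g hg =>
    obtain ⟨u, rfl⟩ := hg
    refine Submodule.subset_span ⟨u ++ [a], ?_⟩
    funext w
    simp [translateOp, LinearMap.funLeft_apply]
  | zero => simp
  | add x y _ _ hx hy => rw [map_add]; exact add_mem hx hy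
  | smul c x _ hx => rw [map_smul]; exact Submodule.smul_mem _ _ hx

/-- The operators `g ↦ (w ↦ g (a w))` on the span of the translates of `f`. -/
def translate (f : List α → ℤ) (a : α) : Module.End ℚ (translateSpan f) :=
  (translateOp a).restrict (translateOp_mem f a)

theorem act_translate_apply (f : List α → ℤ) (w s : List α) (g : translateSpan f) :
    (act (translate f) w g : List α → ℚ) s = (g : List α → ℚ) (w ++ s) := by
  induction w generalizing g with
  | nil => rfl
  | cons a w ih =>
    rw [act_cons, Module.End.mul_apply, ih]
    rfl

/-- The function `f` as a vector in the span of its translates. -/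
def baseVector (f : List α → ℤ) : translateSpan f :=
  ⟨fun w => (f w : ℚ), Submodule.subset_span ⟨[], rfl⟩⟩

/-- Evaluation at the empty word. -/
def evalNil (f : List α → ℤ) : translateSpan f →ₗ[ℚ] ℚ :=
  LinearMap.proj [] ∘ₗ (translateSpan f).subtype

theorem evalNil_act (f : List α → ℤ) (w : List α) (g : translateSpan f) :
    evalNil f (act (translate f) w g) = (g : List α → ℚ) w := by
  have := act_translate_apply f w [] g
  rwa [List.append_nil] at this

theorem evalNil_act_baseVector (f : List α → ℤ) (w : List α) :
    evalNil f (act (translate f) w (baseVector f)) = f w :=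
  evalNil_act f w _

theorem evalNil_separates (f : List α → ℤ) (g : translateSpan f)
    (hg : ∀ w, evalNil f (act (translate f) w g) = 0) : g = 0 := by
  ext w
  rw [← evalNil_act, hg]
  rfl

theorem coe_act_baseVector (f : List α → ℤ) (u : List α) :
    (act (translate f) u (baseVector f) : List α → ℚ) = fun w => (f (u ++ w) : ℚ) := by
  funext w
  exact act_translate_apply f u w _

theorem span_act_baseVector (f : List α → ℤ) :
    Submodule.span ℚ (Set.range fun u => act (translate f) u (baseVector f)) = ⊤ := by
  refine Submodule.map_injective_of_injective (translateSpan f).injective_subtype ?_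
  rw [Submodule.map_span, ← Set.range_comp, Submodule.map_subtype_top]
  exact congrArg (Submodule.span ℚ) (congrArg Set.range (funext fun u => coe_act_baseVector f u))

variable {m : ℕ}

theorem fg_span_act_baseVector {f : List (Fin m) → ℤ} (hf : IsRegular ℤ f) :
    (Submodule.span ℤ (Set.range fun u => act (translate f) u (baseVector f))).FG := by
  let ι : (List (Fin m) → ℤ) →ₗ[ℤ] (List (Fin m) → ℚ) :=
    ((Int.castAddHom ℚ).compLeft (List (Fin m))).toIntLinearMap
  refine Submodule.fg_of_fg_map_injective ((translateSpan f).subtype.restrictScalars ℤ)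
    (translateSpan f).injective_subtype ?_
  have h := Submodule.FG.map ι hf
  rw [Submodule.map_span, ← Set.range_comp] at h ⊢
  convert! h using 3
  funext u
  exact coe_act_baseVector f u

theorem finiteDimensional_translateSpan {f : List (Fin m) → ℤ} (hf : IsRegular ℤ f) :
    FiniteDimensional ℚ (translateSpan f) := by
  obtain ⟨t, ht⟩ := fg_span_act_baseVector hf
  refine ⟨t, ?_⟩
  rw [← Submodule.span_span_of_tower ℤ, ht, Submodule.span_span_of_tower, span_act_baseVector]

end Representation

/-! ### Growth degree versus polynomial bounds -/

section GrowthDegree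

open Filter Topology

variable {m : ℕ} {f : List (Fin m) → ℂ}

theorem exists_bound_of_growthDegree_lt {κ : ℝ} (hκ : 0 ≤ κ) (h : growthDegree f < (κ : EReal)) :
    ∃ C : ℝ, ∀ w, ‖f w‖ ≤ C * ((w.length : ℝ) + 1) ^ κ := by
  obtain ⟨N, hN⟩ := eventually_atTop.1 (eventually_lt_of_limsup_lt h)
  -- The threshold `2` makes the logarithm of the length positive; the shorter words are finitely
  -- many.
  obtain ⟨D, hD⟩ := ((List.finite_length_lt (Fin m) (max N 2)).image fun w => ‖f w‖).bddAbove
  refine ⟨max D 1, fun w => ?_⟩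
  have hone : (1 : ℝ) ≤ ((w.length : ℝ) + 1) ^ κ := Real.one_le_rpow (by simp) hκ
  by_cases hw : w.length < max N 2
  · have h1 : ‖f w‖ ≤ D := hD ⟨w, hw, rfl⟩
    have h2 := le_max_left D 1
    have h3 := le_max_right D 1
    nlinarith
  · rw [not_lt, max_le_iff] at hw
    by_cases h0 : f w = 0
    · rw [h0, norm_zero]
      have h3 := le_max_right D 1
      positivity
    · have h1 := (le_iSup (fun w' : {w' : List (Fin m) // w'.length = w.length} =>
        if f w'.1 = 0 then (⊥ : EReal) else
          ((Real.log ‖f w'.1‖ / Real.log w.length : ℝ) : EReal)) ⟨w, rfl⟩).trans_lt (hN _ hw.1)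
      simp only [h0, if_false, EReal.coe_lt_coe_iff] at h1
      have hlen : (1 : ℝ) < w.length := by exact_mod_cast hw.2
      rw [div_lt_iff₀ (Real.log_pos hlen)] at h1
      have hpos : (0 : ℝ) < w.length := by linarith
      have h2 : ‖f w‖ ≤ (w.length : ℝ) ^ κ := by
        rw [← Real.log_le_log_iff (norm_pos_iff.2 h0) (by positivity), Real.log_rpow hpos]
        exact h1.le
      have h3 : (w.length : ℝ) ^ κ ≤ ((w.length : ℝ) + 1) ^ κ :=
        Real.rpow_le_rpow hpos.le (by linarith) hκ
      have h4 := le_max_right D 1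
      nlinarith

theorem growthDegree_le_of_bound {C : ℝ} {k : ℕ}
    (h : ∀ w, ‖f w‖ ≤ C * ((w.length : ℝ) + 1) ^ k) : growthDegree f ≤ ((k : ℝ) : EReal) := by
  -- Since `n + 1 ≤ 2 * n`, the logarithm of the bound is at most `A + k * log n`.
  set A : ℝ := Real.log (max C 1) + k * Real.log 2
  have ht : Tendsto (fun n : ℕ => ((A / Real.log n + k : ℝ) : EReal)) atTop (𝓝 ((k : ℝ) : EReal)) := by
    refine (continuous_coe_real_ereal.tendsto _).comp ?_
    have := (tendsto_const_nhds (x := A)).div_atTop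
      (Real.tendsto_log_atTop.comp tendsto_natCast_atTop_atTop)
    simpa using this.add_const (k : ℝ)
  rw [← ht.limsup_eq]
  refine limsup_le_limsup ?_
  filter_upwards [eventually_ge_atTop 2] with n hn
  refine iSup_le fun ⟨w, hw⟩ => ?_
  split_ifs with h0
  · exact bot_le
  · have hn' : (2 : ℝ) ≤ n := by exact_mod_cast hn
    have hlog : 0 < Real.log n := Real.log_pos (by linarith)
    rw [EReal.coe_le_coe_iff, div_add' _ _ _ hlog.ne', div_le_div_iff_of_pos_right hlog]
    have hC : (0 : ℝ) < max C 1 := lt_max_of_lt_right one_pos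
    have h1 : ‖f w‖ ≤ max C 1 * (2 * n) ^ k := by
      refine (h w).trans ?_
      rw [hw]
      gcongr
      · exact le_max_left _ _
      · linarith
    have h2 := Real.log_le_log (norm_pos_iff.2 h0) h1
    rw [Real.log_mul hC.ne' (by positivity), Real.log_pow,
      Real.log_mul two_ne_zero (by positivity)] at h2
    simp only [A]
    linarith

/-- Nonzero integers have absolute value at least one, and non-degeneracy supplies them at
arbitrarily large lengths. -/
theorem growthDegree_nonneg {f : List (Fin m) → ℤ} (hf : ¬ IsDegenerate f) :
    0 ≤ growthDegree fun w => (f w : ℂ) := by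
  refine le_limsup_of_frequently_le (frequently_atTop.2 fun N => ?_)
  unfold IsDegenerate at hf
  push Not at hf
  obtain ⟨w, hw, h0⟩ := hf N
  refine ⟨w.length, hw, le_trans ?_ (le_iSup (fun w' : {w' : List (Fin m) // w'.length = w.length} =>
    if ((f w'.1 : ℤ) : ℂ) = 0 then (⊥ : EReal) else
      ((Real.log ‖((f w'.1 : ℤ) : ℂ)‖ / Real.log w.length : ℝ) : EReal)) ⟨w, rfl⟩)⟩
  have h1 : ((f w : ℤ) : ℂ) ≠ 0 := by exact_mod_cast h0
  simp only [h1, if_false]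
  have h2 : (1 : ℝ) ≤ ‖((f w : ℤ) : ℂ)‖ := by
    rw [Complex.norm_intCast]
    exact_mod_cast Int.one_le_abs h0
  exact_mod_cast div_nonneg (Real.log_nonneg h2) (Real.log_natCast_nonneg _)

/-- A real polynomial bounded on the natural numbers by a multiple of `(n + 1) ^ κ` has no
nonzero coefficient of degree above `κ`. -/
theorem le_of_coeff_ne_zero_of_bound {P : Polynomial ℝ} {k : ℕ} (hk : P.coeff k ≠ 0) {C κ : ℝ}
    (hκ : 0 ≤ κ) (h : ∀ n : ℕ, |P.eval (n : ℝ)| ≤ C * ((n : ℝ) + 1) ^ κ) : (k : ℝ) ≤ κ := by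
  by_contra! hlt
  have hO : (fun x : ℝ => Polynomial.eval x (Polynomial.X ^ k : Polynomial ℝ)) =O[atTop]
      fun x => P.eval x := by
    refine Polynomial.isBigO_atTop_of_degree_le _ _ ?_
    rw [Polynomial.degree_X_pow]
    exact Polynomial.le_degree_of_ne_zero hk
  obtain ⟨D, hDpos, hD⟩ := (hO.comp_tendsto tendsto_natCast_atTop_atTop).exists_pos
  have htend : Tendsto (fun n : ℕ => (n : ℝ) ^ ((k : ℝ) - κ)) atTop atTop :=
    (tendsto_rpow_atTop (sub_pos.2 hlt)).comp tendsto_natCast_atTop_atTop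
  have hev := htend.eventually_gt_atTop (D * (C * 2 ^ κ))
  obtain ⟨n, h1, h2, h3⟩ := (hD.bound.and (hev.and (eventually_ge_atTop 1))).exists
  have hn : (1 : ℝ) ≤ n := by exact_mod_cast h3
  have hnpos : (0 : ℝ) < n := by linarith
  have hC : 0 ≤ C := by
    have := (abs_nonneg _).trans (h 0)
    simpa using this
  simp only [Function.comp_apply, Polynomial.eval_pow, Polynomial.eval_X, Real.norm_eq_abs,
    abs_pow, Nat.abs_cast] at h1
  have h4 : (n : ℝ) ^ k ≤ D * (C * 2 ^ κ) * (n : ℝ) ^ κ := by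
    refine h1.trans ?_
    rw [mul_assoc, mul_assoc, ← Real.mul_rpow two_pos.le hnpos.le]
    refine mul_le_mul_of_nonneg_left ((h n).trans ?_) hDpos.le
    exact mul_le_mul_of_nonneg_left (Real.rpow_le_rpow (by linarith) (by linarith) hκ) hC
  rw [Real.rpow_sub hnpos, Real.rpow_natCast, lt_div_iff₀ (by positivity)] at h2
  linarith

/-- A smaller growth degree would bound `f` by a power `κ < k` of the length, hence `P` by a
multiple of `(t + 1) ^ κ` as lengths are linear in `t`. -/
theorem le_growthDegree_of_polynomial {f : List (Fin m) → ℤ} (hf : ¬ IsDegenerate f)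
    {w : ℕ → List (Fin m)} {C k : ℕ} (hw : ∀ t, (w t).length ≤ C * (t + 1)) {P : Polynomial ℝ}
    {i : ℕ} (hki : k ≤ i) (hi : P.coeff i ≠ 0) (hP : ∀ t : ℕ, P.eval (t : ℝ) = f (w t)) :
    ((k : ℝ) : EReal) ≤ growthDegree fun w => (f w : ℂ) := by
  by_contra! hlt
  obtain ⟨κ, hκ, hκk⟩ := EReal.lt_iff_exists_real_btwn.1 hlt
  have h0 : 0 ≤ κ := by
    have := (growthDegree_nonneg hf).trans_lt hκ
    exact_mod_cast this.le
  obtain ⟨D, hD⟩ := exists_bound_of_growthDegree_lt h0 hκ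
  have hDpos : 0 ≤ D := by
    have := (norm_nonneg _).trans (hD [])
    simpa using this
  have := le_of_coeff_ne_zero_of_bound hi (C := D * ((C : ℝ) + 1) ^ κ) h0 fun n => ?_
  · rw [EReal.coe_lt_coe_iff] at hκk
    have hki' : (k : ℝ) ≤ i := by exact_mod_cast hki
    linarith
  · rw [hP]
    have h1 := hD (w n)
    rw [Complex.norm_intCast] at h1
    refine h1.trans ?_
    rw [mul_assoc, ← Real.mul_rpow (by positivity) (by positivity)]
    have h2 : ((w n).length : ℝ) ≤ C * (n + 1) := by exact_mod_cast hw n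
    refine mul_le_mul_of_nonneg_left (Real.rpow_le_rpow (by positivity) ?_ h0) hDpos
    have : (0 : ℝ) ≤ n := n.cast_nonneg
    linarith

end GrowthDegree

/-! ### Assembly: the first layer containing `f` gives its degree -/

/-- A non-degenerate integer-valued regular function of polynomial growth has an integral growth
degree and lies in `R₀`. -/
theorem growthDegree_and_mem_R₀_of_bound {m : ℕ} {f : List (Fin m) → ℤ} (hreg : IsRegular ℤ f)
    (hnd : ¬ IsDegenerate f) {C₀ : ℚ} {K : ℕ}
    (hC₀ : ∀ w, |(f w : ℚ)| ≤ C₀ * ((w.length : ℚ) + 1) ^ K) :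
    (∃ k : ℕ, growthDegree (fun w => (f w : ℂ)) = ((k : ℝ) : EReal)) ∧
      WordSeries.of (fun w => (f w : ℂ)) ∈ R₀ m := by
  have := finiteDimensional_translateSpan hreg
  set T := translate f
  set v := baseVector f
  set ψ := evalNil f
  have hψ (w : List (Fin m)) : ψ (act T w v) = f w := evalNil_act_baseVector f w
  obtain ⟨l, hl⟩ := exists_iterate_finMod_eq_top (finite_range_trace (span_act_baseVector f)
    (fg_span_act_baseVector hreg) (evalNil_separates f) (C₀ := C₀) (k := K)
    fun w => (hψ w).symm ▸ hC₀ w)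
  have hvl : v ∈ (finMod T)^[l] ⊥ := hl ▸ trivial
  constructor
  · classical
    have hex : ∃ n, v ∈ (finMod T)^[n] ⊥ := ⟨l, hvl⟩
    -- Layer `0` is `⊥`, which non-degeneracy excludes; so the first layer has an index `k + 1`, and
    -- `k` is the degree.
    have hpos : Nat.find hex ≠ 0 := by
      intro h0
      have h1 : v ∈ (finMod T)^[0] ⊥ := h0 ▸ Nat.find_spec hex
      refine hnd ⟨0, fun w _ => ?_⟩
      have h2 := hψ w
      rw [(Submodule.mem_bot ℚ).1 h1, map_zero, map_zero] at h2
      exact_mod_cast h2.symm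
    obtain ⟨k, hk⟩ := Nat.exists_eq_add_one_of_ne_zero hpos
    have hmem : v ∈ (finMod T)^[k + 1] ⊥ := hk ▸ Nat.find_spec hex
    have hnot : v ∉ (finMod T)^[k + 0] ⊥ := Nat.find_min hex (by omega)
    refine ⟨k, le_antisymm ?_ ?_⟩
    · obtain ⟨C, hC⟩ := exists_polynomial_bound ψ k hmem
      refine growthDegree_le_of_bound (C := C) fun w => ?_
      have h := hC w
      rw [hψ] at h
      rw [Complex.norm_intCast]
      exact_mod_cast h
    · obtain ⟨w, C, d, z, hlen, hw, i, hki, hid, hz⟩ := exists_polynomial_curve hl k 0 hnot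
      -- Appending a fixed word `s` makes the nonzero vector coefficient visible to evaluation at
      -- the empty word.
      obtain ⟨s, hs⟩ : ∃ s, ψ (act T s (z i)) ≠ 0 := by
        by_contra! H
        exact hz ((Submodule.mem_bot ℚ).2 (evalNil_separates f _ H))
      let P : Polynomial ℝ := ∑ j ∈ Finset.range d,
        Polynomial.C ((ψ (act T s (z j)) : ℚ) : ℝ) * Polynomial.X ^ j
      refine le_growthDegree_of_polynomial hnd (w := fun t => w t ++ s) (C := C + s.length) (P := P)
        (fun t => ?_) hki ?_ fun t => ?_
      · have := hlen t
        rw [List.length_append]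
        nlinarith [Nat.zero_le (s.length * t)]
      · simpa [P, Polynomial.finsetSum_coeff, Polynomial.coeff_X_pow, hid] using hs
      · have h := hψ (w t ++ s)
        rw [act_append, Module.End.mul_apply, hw] at h
        simp only [map_sum, map_smul, smul_eq_mul] at h
        simp only [P, Polynomial.eval_finsetSum, Polynomial.eval_mul, Polynomial.eval_C,
          Polynomial.eval_pow, Polynomial.eval_X]
        rw [show ((f (w t ++ s) : ℤ) : ℝ) = (((f (w t ++ s) : ℤ) : ℚ) : ℝ) by norm_cast, ← h]
        push_cast
        exact Finset.sum_congr rfl fun j _ => mul_comm _ _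
  · have h := matrixCoeff_mem_R₀ ψ l hvl
    convert! h using 1
    funext w
    simp [WordSeries.of, matrixCoeff, hψ]

end RegularSeq

end

theorem theorem1p2 (m : ℕ) (f : List (Fin m) → ℤ)
    (hreg : RegularSeq.IsRegular ℤ f) (hnd : ¬ RegularSeq.IsDegenerate f) :
    ((∃ k : ℕ, RegularSeq.growthDegree (fun w => (f w : ℂ)) = ((k : ℝ) : EReal)) ∨
      RegularSeq.growthDegree (fun w => (f w : ℂ)) = ⊤) ∧
    ((∃ k : ℕ, RegularSeq.growthDegree (fun w => (f w : ℂ)) = ((k : ℝ) : EReal)) ↔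
      RegularSeq.WordSeries.of (fun w => (f w : ℂ)) ∈ RegularSeq.R₀ m) := by
  have key (h : RegularSeq.growthDegree (fun w => (f w : ℂ)) ≠ ⊤) :
      (∃ k : ℕ, RegularSeq.growthDegree (fun w => (f w : ℂ)) = ((k : ℝ) : EReal)) ∧
        RegularSeq.WordSeries.of (fun w => (f w : ℂ)) ∈ RegularSeq.R₀ m := by
    obtain ⟨κ, hκ, -⟩ := EReal.lt_iff_exists_real_btwn.1 (lt_top_iff_ne_top.2 h)
    obtain ⟨K, hK⟩ := exists_nat_ge κ
    obtain ⟨C, hC⟩ := RegularSeq.exists_bound_of_growthDegree_lt (κ := K) K.cast_nonneg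
      (hκ.trans_le (EReal.coe_le_coe_iff.2 hK))
    obtain ⟨C₀, hC₀⟩ := exists_rat_gt C
    refine RegularSeq.growthDegree_and_mem_R₀_of_bound hreg hnd (C₀ := C₀) (K := K) fun w => ?_
    have h1 := hC w
    rw [Complex.norm_intCast, Real.rpow_natCast] at h1
    have h2 : |(f w : ℝ)| ≤ C₀ * ((w.length : ℝ) + 1) ^ K :=
      h1.trans (mul_le_mul_of_nonneg_right hC₀.le (by positivity))
    exact_mod_cast h2
  refine ⟨?_, fun ⟨k, hk⟩ => (key (hk ▸ EReal.coe_ne_top _)).2, fun hR => (key ?_).1⟩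
  · by_cases h : RegularSeq.growthDegree (fun w => (f w : ℂ)) = ⊤
    · exact Or.inr h
    · exact Or.inl (key h).1
  · obtain ⟨C, k, hC⟩ := RegularSeq.exists_bound_of_mem_R₀ hR
    exact ((RegularSeq.growthDegree_le_of_bound hC).trans_lt (EReal.coe_lt_top _)).ne
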